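/- Let $\mathbf T^4=(\mathbf R/2\pi\mathbf Z)^4$, let $G$ be the Green's function of $1-\Delta$ on $\mathbf T^4$, and for $\varepsilon\in(0,1)$ let $G_\varepsilon=\varrho_\varepsilon\star G$ with $\varrho_\varepsilon(x)=\varepsilon^{-4}\varrho(x/\varepsilon)$, where $\varrho\ge 0$ is a radial, smooth, compactly supported function on $\mathbf R^4$ with $\int\varrho=1$. For $\hat\lambda\in\mathbf R$ set $\lambda_\varepsilon=\hat\lambda\,(\log\tfrac1\varepsilon)^{-1/2}$. Let $\mathcal I_n$ ($n\ge1$) be the directed path with $n$ internal vertices between a bottom leaf and a top leaf, with $n+1$ edges pointing upwards. For $k\ge1$, $n_1,\dots,n_k\ge1$ and a complete pairing $\kappa$ of all the internal vertices of $\mathcal I_{n_1},\dots,\mathcal I_{n_k}$ (a fixed-point-free involution), let $\Gamma=(\mathcal I_{n_1},\dots,\mathcal I_{n_k})_\kappa$ be the directed multigraph obtained by identifying paired vertices; it is called a $2k$-Anderson–Feynman diagram. Let $L$ be the set of its $2k$ leaves, $V_\star$ the set of its other (internal) vertices, $E$ the multiset of its edges and $E_\star$ that of the internal edges, i.e. those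 between internal vertices. For $\varphi\in C^\infty((\mathbf T^4)^L;\mathbf R)$ set $$\Pi_\varepsilon\Gamma(x_L)=\int_{(\mathbf T^4)^{V_\star}}\prod_{e\in E}G_\varepsilon(x_{e_+}-x_{e_-})\,\mathrm dx_{V_\star},\qquad \Pi_\varepsilon\Gamma(\varphi)=\int_{(\mathbf T^4)^L}\Pi_\varepsilon\Gamma(x_L)\,\varphi(x_L)\,\mathrm dx_L .$$ A subdiagram $\bar\Gamma=(\bar V,\bar E)$ of $\Gamma$ consists of a set of internal vertices and a sub-multiset of the internal edges between them. Its degree is the sum over its connected components of $4(|\bar V|-1)-2|\bar E|$. It is full if it contains all parallel copies of each of its edges. $\Gamma$ is positive if every subdiagram with at least one edge has degree $>0$; it has zero degree if every subdiagram has degree $\ge0$ and some subdiagram with at least one edge has degree $0$. $\Gamma$ is a nested bubble diagram if, by successively contracting full bubbles (two distinct internal vertices joined by exactly two, parallel or opposite, edges) to single vertices and deleting the two edges, it can be reduced to the diagram with one internal vertex, four legs and no internal edges. Let further $\hat\Pi_\varepsilon\Gamma=\sum_{\mathfrak F}(-1)^{|\mathfrak F|}\,\Pi_\varepsilon\mathcal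 C_{\mathfrak F}\Gamma$ be the BPHZ-renormalised valuation. The sum runs over all forests $\mathfrak F$, i.e. sets of connected full subdiagrams of negative degree, any two of which are nested or vertex-disjoint. $\mathcal C_{\mathfrak F}\Gamma$ is the product of $\Gamma$, with the maximal elements of $\mathfrak F$ contracted to points, and of all $\gamma\in\mathfrak F$, with the maximal elements of $\mathfrak F$ strictly inside $\gamma$ contracted to points. $\Pi_\varepsilon$ is multiplicative, and connected diagrams without leaves are integrated over all variables but one. 1. For all $k,m$ and every $\varepsilon_0\in(0,1)$ there is a constant $C$ (depending only on $k$, $m$, $\varepsilon_0$ and $\varrho$) such that for every connected $2k$-Anderson–Feynman diagram $\Gamma$ with $|E_\star|=m$ that is positive or has zero degree, every $\varphi$ and every $\hat\lambda\in\mathbf R$, $$\sup_{\varepsilon\in(0,\varepsilon_0]}|\lambda_\varepsilon|^{|E_\star|}\,|\Pi_\varepsilon\Gamma(\varphi)|\le C\,\|\varphi\|_\infty\,|\hat\lambda|^{|E_\star|}.$$ 2. If $\Gamma$ is a connected $2k$-Anderson–Feynman diagram that is positive or has zero degree, and if $k\ne2$ or $\Gamma$ is not a nested bubble diagram, then $\lim_{\varepsilon\to0}|\lambda_\varepsilon|^{|E_\star|}\,|\Pi_\varepsilon\Gamma(\varphi)|=0$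 for all $\varphi$ and $\hat\lambda$. 3. If $\Gamma=(\mathcal I_{n_1},\dots,\mathcal I_{n_k})_\kappa$ is positive (connected or not), then $\hat\Pi_\varepsilon\Gamma=\Pi_\varepsilon\Gamma$ for all $\varepsilon\in(0,1)$, and $\sup_{\varepsilon\in(0,1)}|\Pi_\varepsilon\Gamma(\varphi)|<\infty$ for every $\varphi$. If moreover $\Gamma$ has at least one internal edge (i.e. some $n_i\ge2$), then $\Gamma$ does not contribute: $\lim_{\varepsilon\to0}\lambda_\varepsilon^{\sum_i(n_i-1)}\,\hat\Pi_\varepsilon\Gamma(\varphi)=0$ for all $\varphi$ and $\hat\lambda$. -/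

import Mathlib

open scoped Topology

noncomputable section

namespace AndersonFeynman

/-! ### The torus, the Green's function and the weak coupling constant -/

instance two_pi_pos_fact : Fact (0 < 2 * Real.pi) := ⟨Real.two_pi_pos⟩

/-- The torus `𝐓⁴ = (ℝ / 2πℤ)⁴`; its `volume` is Lebesgue measure, of total mass `(2π)⁴`. -/
abbrev Torus : Type := Fin 4 → AddCircle (2 * Real.pi)

/-- The projection `ℝ⁴ → 𝐓⁴`. -/
def toTorus (y : EuclideanSpace ℝ (Fin 4)) : Torus := fun i => (y i : AddCircle (2 * Real.pi))

/-- The heat kernel of `∂ₜ - Δ` on `ℝ⁴`. -/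
def heatKernel (t : ℝ) (y : EuclideanSpace ℝ (Fin 4)) : ℝ :=
  1 / (4 * Real.pi * t) ^ 2 * Real.exp (-(‖y‖ ^ 2) / (4 * t))

/-- The heat kernel on `𝐓⁴`: the periodisation of the one on `ℝ⁴`,
i.e. the sum over all representatives of the point `x`. -/
def torusHeatKernel (t : ℝ) (x : Torus) : ℝ :=
  ∑' y : {y : EuclideanSpace ℝ (Fin 4) // toTorus y = x}, heatKernel t y

/-- The Green's function of `1 - Δ` on `𝐓⁴`, i.e. the kernel of
`(1 - Δ)⁻¹ = ∫₀^∞ e^{-t} e^{tΔ} dt`. It is finite and positive off the origin. -/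
def green (x : Torus) : ℝ :=
  ∫ t in Set.Ioi (0 : ℝ), Real.exp (-t) * torusHeatKernel t x

/-- The admissible mollifiers: smooth, compactly supported, nonnegative, radial, of mass one. -/
structure IsMollifier (ρ : EuclideanSpace ℝ (Fin 4) → ℝ) : Prop where
  smooth : ContDiff ℝ (⊤ : ℕ∞) ρ
  compact_support : HasCompactSupport ρ
  nonneg : ∀ y, 0 ≤ ρ y
  radial : ∀ y z, ‖y‖ = ‖z‖ → ρ y = ρ z
  mass_one : ∫ y, ρ y = 1

/-- The mollified Green's function `G_ε = ρ_ε ⋆ G`, where `ρ_ε(y) = ε⁻⁴ ρ(y / ε)`. -/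
def greenMoll (ρ : EuclideanSpace ℝ (Fin 4) → ℝ) (ε : ℝ) (x : Torus) : ℝ :=
  ∫ y : EuclideanSpace ℝ (Fin 4), (ε ^ 4)⁻¹ * ρ (ε⁻¹ • y) * green (x - toTorus y)

/-- The coupling constant `λ_ε = λ̂ (log (1/ε))^{-1/2}`. -/
def coupling (lam ε : ℝ) : ℝ := lam * Real.log (1 / ε) ^ (-(1 / 2) : ℝ)

/-- `φ` belongs to `C^∞((𝐓⁴)^L; ℝ)`: its `2π`-periodic lift to `(ℝ⁴)^L` is smooth. -/
def IsSmooth {L : Type} [Fintype L] (φ : (L → Torus) → ℝ) : Prop :=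
  ContDiff ℝ (⊤ : ℕ∞)
    (fun y : L → Fin 4 → ℝ => φ fun l i => (y l i : AddCircle (2 * Real.pi)))

/-! ### Feynman diagrams -/

/-- A Feynman diagram: a finite directed multigraph with vertex set `I ⊕ L`, where `I` are the
internal vertices (`V⋆`) and `L` the leaves. Edges are labelled by `E`, so that two different
labels with the same endpoints are parallel edges. -/
structure FeynmanDiagram : Type 1 where
  I : Type
  L : Type
  E : Type
  [fintypeI : Fintype I]
  [fintypeL : Fintype L]
  [fintypeE : Fintype E]
  src : E → I ⊕ L
  tgt : E → I ⊕ L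

namespace FeynmanDiagram

attribute [instance] fintypeI fintypeL fintypeE

variable (Γ : FeynmanDiagram)

/-- The internal edges `E⋆`, i.e. those with both endpoints internal. -/
def intEdges : Set Γ.E :=
  {e | (∃ v, Γ.src e = Sum.inl v) ∧ ∃ w, Γ.tgt e = Sum.inl w}

/-- The number `|E⋆|` of internal edges. -/
def numIntEdges : ℕ := Γ.intEdges.ncard

/-- The underlying simple undirected graph, which determines the connected components. -/
def graph : SimpleGraph (Γ.I ⊕ Γ.L) :=
  SimpleGraph.fromRel fun a b => ∃ e, Γ.src e = a ∧ Γ.tgt e = b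

/-- Connected (in particular non-empty) diagrams. -/
def Connected : Prop := Γ.graph.Connected

/-! ### Valuation -/

/-- In a connected component without leaves the variable of one (arbitrary) vertex is not
integrated over. `Γ.Pinned v` says that `v` is this vertex in its component. -/
def Pinned (v : Γ.I) : Prop :=
  (∀ l, ¬ Γ.graph.Reachable (Sum.inl v) (Sum.inr l)) ∧
    Quot.out (Γ.graph.connectedComponentMk (Sum.inl v)) = Sum.inl v

/-- The vertices whose variables are integrated over; all of `V⋆` if every component of the
diagram has a leaf. -/
abbrev Free : Type := {v : Γ.I // ¬ Γ.Pinned v}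

open Classical in
instance fintypeFree : Fintype Γ.Free := Fintype.ofFinite _

open Classical in
/-- The variable attached to a vertex, given the integration variables `y` and the leaf variables
`x`; pinned vertices sit at `0` (the position is irrelevant, by translation invariance). -/
def position (y : Γ.Free → Torus) (x : Γ.L → Torus) : Γ.I ⊕ Γ.L → Torus
  | Sum.inl v => if h : Γ.Pinned v then 0 else y ⟨v, h⟩
  | Sum.inr l => x l

/-- The valuation `Π_ε Γ (x_L) = ∫ ∏_e G_ε(x_{e₊} - x_{e₋}) dx`, where the product runs over all
edges, internal ones and legs. For disconnected diagrams this single integral is the product of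
the valuations of the connected components, since the integrand factorises. -/
def val (ρ : EuclideanSpace ℝ (Fin 4) → ℝ) (ε : ℝ) (x : Γ.L → Torus) : ℝ :=
  ∫ y : Γ.Free → Torus,
    ∏ e : Γ.E, greenMoll ρ ε (Γ.position y x (Γ.tgt e) - Γ.position y x (Γ.src e))

/-- The tested valuation `Π_ε Γ (φ)`. -/
def valTest (ρ : EuclideanSpace ℝ (Fin 4) → ℝ) (ε : ℝ) (φ : (Γ.L → Torus) → ℝ) : ℝ :=
  ∫ x : Γ.L → Torus, Γ.val ρ ε x * φ x

/-! ### Subdiagrams, degree -/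

/-- A subdiagram: a set of internal vertices and a set of internal edges between them. -/
@[ext]
structure Subdiagram where
  verts : Set Γ.I
  edges : Set Γ.E
  src_mem : ∀ e ∈ edges, ∃ v ∈ verts, Γ.src e = Sum.inl v
  tgt_mem : ∀ e ∈ edges, ∃ v ∈ verts, Γ.tgt e = Sum.inl v

variable {Γ}

namespace Subdiagram

theorem toProd_injective :
    Function.Injective fun γ : Γ.Subdiagram => (γ.verts, γ.edges) := by
  intro γ δ h
  have h' := Prod.mk.inj h
  exact Subdiagram.ext h'.1 h'.2

/-- Inclusion of subdiagrams: inclusion of vertices and of edges. -/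
instance partialOrder : PartialOrder Γ.Subdiagram :=
  PartialOrder.lift _ toProd_injective

instance finite : Finite Γ.Subdiagram := Finite.of_injective _ toProd_injective

open Classical in
instance fintype : Fintype Γ.Subdiagram := Fintype.ofFinite _

open Classical in
/-- A subdiagram, seen as a Feynman diagram without leaves. -/
def toDiagram (γ : Γ.Subdiagram) : FeynmanDiagram where
  I := {v : Γ.I // v ∈ γ.verts}
  L := Empty
  E := {e : Γ.E // e ∈ γ.edges}
  fintypeI := Fintype.ofFinite _
  fintypeE := Fintype.ofFinite _
  src e := Sum.inl ⟨(γ.src_mem e.1 e.2).choose, (γ.src_mem e.1 e.2).choose_spec.1⟩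
  tgt e := Sum.inl ⟨(γ.tgt_mem e.1 e.2).choose, (γ.tgt_mem e.1 e.2).choose_spec.1⟩

/-- Connected (in particular non-empty) subdiagrams. -/
def Connected (γ : Γ.Subdiagram) : Prop := γ.toDiagram.Connected

/-- Full subdiagrams: with an edge `e = (e₋, e₊)` they contain all its parallel copies. -/
def Full (γ : Γ.Subdiagram) : Prop :=
  ∀ e ∈ γ.edges, ∀ e', Γ.src e' = Γ.src e → Γ.tgt e' = Γ.tgt e → e' ∈ γ.edges

/-- The degree: the sum over the connected components of `4 (|V| - 1) - 2 |E|`. -/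
def degree (γ : Γ.Subdiagram) : ℤ :=
  4 * ((γ.verts.ncard : ℤ) - (Nat.card γ.toDiagram.graph.ConnectedComponent : ℤ))
    - 2 * (γ.edges.ncard : ℤ)

/-- The bubble: two distinct vertices joined by two edges, which are either parallel or
opposite. -/
def IsBubble (γ : Γ.Subdiagram) : Prop :=
  ∃ v w : Γ.I, v ≠ w ∧ γ.verts = {v, w} ∧ γ.edges.ncard = 2 ∧
    ∀ e ∈ γ.edges, (Γ.src e = Sum.inl v ∧ Γ.tgt e = Sum.inl w) ∨
      (Γ.src e = Sum.inl w ∧ Γ.tgt e = Sum.inl v)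

/-- The part of `δ` inside `γ`, as a subdiagram of the diagram `γ`
(this is `δ` itself when `δ ≤ γ`). -/
def restrict (γ δ : Γ.Subdiagram) : γ.toDiagram.Subdiagram where
  verts := {v | v.1 ∈ δ.verts}
  edges := {e | e.1 ∈ δ.edges}
  src_mem := by
    intro e he
    obtain ⟨v, hv, hve⟩ := δ.src_mem e.1 he
    refine ⟨_, ?_, rfl⟩
    have h : (γ.src_mem e.1 e.2).choose = v :=
      Sum.inl.inj ((γ.src_mem e.1 e.2).choose_spec.2.symm.trans hve)
    have h' : (γ.src_mem e.1 e.2).choose ∈ δ.verts := h.symm ▸ hv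
    exact h'
  tgt_mem := by
    intro e he
    obtain ⟨v, hv, hve⟩ := δ.tgt_mem e.1 he
    refine ⟨_, ?_, rfl⟩
    have h : (γ.tgt_mem e.1 e.2).choose = v :=
      Sum.inl.inj ((γ.tgt_mem e.1 e.2).choose_spec.2.symm.trans hve)
    have h' : (γ.tgt_mem e.1 e.2).choose ∈ δ.verts := h.symm ▸ hv
    exact h'

end Subdiagram

variable (Γ)

/-- Positive diagrams. Subdiagrams without edges always have degree zero and are disregarded. -/
def IsPositive : Prop :=
  ∀ γ : Γ.Subdiagram, γ.edges.Nonempty → 0 < γ.degree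

/-- Zero degree diagrams. Again subdiagrams without edges are disregarded. -/
def IsZeroDegree : Prop :=
  (∀ γ : Γ.Subdiagram, 0 ≤ γ.degree) ∧ ∃ γ : Γ.Subdiagram, γ.edges.Nonempty ∧ γ.degree = 0

/-! ### Contractions and nested bubble diagrams -/

open Classical in
/-- The diagram obtained by contracting each member of a family of (connected, vertex-disjoint)
subdiagrams to a vertex of its own and deleting their edges. -/
def contract (S : Set Γ.Subdiagram) : FeynmanDiagram where
  I := Quot fun v w : Γ.I => ∃ γ ∈ S, v ∈ γ.verts ∧ w ∈ γ.verts
  L := Γ.L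
  E := {e : Γ.E // ∀ γ ∈ S, e ∉ γ.edges}
  fintypeI := Fintype.ofFinite _
  fintypeE := Fintype.ofFinite _
  src e := Sum.map (Quot.mk _) id (Γ.src e.1)
  tgt e := Sum.map (Quot.mk _) id (Γ.tgt e.1)

/-- The diagram with a single internal vertex, no internal edges and four legs, each of which
joins a leaf of its own to that vertex. -/
def IsCross : Prop :=
  Nat.card Γ.I = 1 ∧ Nat.card Γ.L = 4 ∧ Γ.intEdges = ∅ ∧
    (∀ e, (∃ l v, Γ.src e = Sum.inr l ∧ Γ.tgt e = Sum.inl v) ∨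
      (∃ v l, Γ.src e = Sum.inl v ∧ Γ.tgt e = Sum.inr l)) ∧
    ∀ l, ∃! e, Γ.src e = Sum.inr l ∨ Γ.tgt e = Sum.inr l

/-- Nested bubble diagrams: those that become a cross after successive contractions of (full)
bubbles. Each contraction removes one internal vertex, so that a diagram with `n` internal
vertices takes exactly `n - 1` of them. -/
inductive IsNestedBubble : FeynmanDiagram → Prop
  | cross (Γ : FeynmanDiagram) (h : Γ.IsCross) : IsNestedBubble Γ
  | bubble (Γ : FeynmanDiagram) (γ : Γ.Subdiagram) (hγ : γ.IsBubble) (hfull : γ.Full)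
      (h : IsNestedBubble (Γ.contract {γ})) : IsNestedBubble Γ

/-! ### BPHZ renormalisation -/

/-- The divergent subdiagrams `𝒢⁻_Γ`. -/
def divergent : Set Γ.Subdiagram :=
  {γ | γ.Connected ∧ γ.Full ∧ γ.degree < 0}

open Classical in
/-- The forests `ℱ⁻_Γ`: sets of divergent subdiagrams, any two of which are either nested or
vertex-disjoint. -/
def forests : Finset (Finset Γ.Subdiagram) :=
  Finset.univ.filter fun F => (∀ γ ∈ F, γ ∈ Γ.divergent) ∧
    ∀ γ ∈ F, ∀ δ ∈ F, γ ≤ δ ∨ δ ≤ γ ∨ Disjoint γ.verts δ.verts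

variable {Γ}

/-- The maximal elements of a forest. -/
def roots (F : Finset Γ.Subdiagram) : Set Γ.Subdiagram :=
  {γ | Maximal (fun δ => δ ∈ F) γ}

/-- The maximal elements of a forest among those strictly contained in `γ`. -/
def children (F : Finset Γ.Subdiagram) (γ : Γ.Subdiagram) : Set Γ.Subdiagram :=
  {δ | Maximal (fun δ' => δ' ∈ F ∧ δ' < γ) δ}

variable (Γ)

/-- `Π_ε` applied to the extraction `𝒞_F Γ = Γ / roots(F) · ∏_{γ ∈ F} γ / children(γ)`. -/
def valExtract (ρ : EuclideanSpace ℝ (Fin 4) → ℝ) (ε : ℝ) (F : Finset Γ.Subdiagram)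
    (x : Γ.L → Torus) : ℝ :=
  (Γ.contract (roots F)).val ρ ε x *
    ∏ γ ∈ F, (γ.toDiagram.contract (γ.restrict '' children F γ)).val ρ ε (fun l => nomatch l)

/-- The BPHZ renormalised valuation, given by Zimmermann's forest formula
`∑_F (-1)^{|F|} Π_ε 𝒞_F Γ`. -/
def renVal (ρ : EuclideanSpace ℝ (Fin 4) → ℝ) (ε : ℝ) (x : Γ.L → Torus) : ℝ :=
  ∑ F ∈ Γ.forests, (-1) ^ F.card * Γ.valExtract ρ ε F x

/-- The tested renormalised valuation. -/
def renValTest (ρ : EuclideanSpace ℝ (Fin 4) → ℝ) (ε : ℝ) (φ : (Γ.L → Torus) → ℝ) : ℝ :=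
  ∫ x : Γ.L → Torus, Γ.renVal ρ ε x * φ x

end FeynmanDiagram

/-! ### Anderson–Feynman diagrams -/

/-- A complete pairing of the internal vertices of the linear trees `ℐ_{n₁}, …, ℐ_{n_k}`, where
`⟨i, j⟩` is the `(j+1)`-st internal vertex, from the bottom, of the `i`-th tree. -/
structure Pairing {k : ℕ} (n : Fin k → ℕ) where
  toFun : (Σ i, Fin (n i)) → (Σ i, Fin (n i))
  involutive : ∀ a, toFun (toFun a) = a
  no_fixed : ∀ a, toFun a ≠ a

open Classical in
/-- The `2k`-Anderson–Feynman diagram `(ℐ_{n₁}, …, ℐ_{n_k})_κ`. The tree `ℐ_n` is the directed path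
with `n` internal vertices between a bottom leaf and a top leaf; its `n + 1` edges point upwards.
Here `(i, false)` and `(i, true)` are the bottom and the top leaf of the `i`-th tree, `⟨i, j⟩` is
its edge number `j` from the bottom, and vertices paired by `κ` are identified. -/
def paired {k : ℕ} (n : Fin k → ℕ) (κ : Pairing n) : FeynmanDiagram where
  I := Quot fun a b : (Σ i, Fin (n i)) => b = κ.toFun a
  L := Fin k × Bool
  E := Σ i, Fin (n i + 1)
  fintypeI := Fintype.ofFinite _
  src e := Fin.cases (motive := fun _ => _) (Sum.inr (e.1, false))
    (fun j => Sum.inl (Quot.mk _ ⟨e.1, j⟩)) e.2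
  tgt e := Fin.lastCases (motive := fun _ => _) (Sum.inr (e.1, true))
    (fun j => Sum.inl (Quot.mk _ ⟨e.1, j⟩)) e.2

end AndersonFeynman

end

namespace AndersonFeynman
open MeasureTheory Set

/-! The proof is power counting organised by Kruskal's algorithm. Since `|G_ε(x)| ≤ A (‖x‖ + ε)⁻²`
(`exists_greenMoll_le`) and a leg integrated over its leaf is bounded uniformly in `ε`, everything
reduces to the integral over the internal vertices of the product of `(‖x_u - x_v‖ + ε)⁻²` over the
internal edges. For a given configuration, repeatedly merge the two closest clusters. The merging
pairs form a spanning tree with increasing lengths, and every edge is at least as long as the tree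
edge at whose merge it is absorbed (`prod_edges_le`). In the tree differences as variables
(`lintegral_comp_differences`), the integral is dominated by a sum, over the finitely many merge
sequences, of nested integrals.

Let `e_i` be the number of edges absorbed in the first `i` merges. The nested integral then sees the
exponent `S_i = 4i - 2e_i` at scale `i ≥ 1`: a positive `S_i` costs a constant, a vanishing one
costs a factor `log(1/ε)` (`lintegral_orderedSet_le`, `lintegral_graph_le`). Now `S_i` is at least
the degree of an actual subdiagram (`degree_fibreSubdiagram_le`), so it is nonnegative under either
hypothesis, and positive when the diagram is positive.

Each logarithm is paid for by two couplings, since `λ_ε² log(1/ε) = λ̂²`. As `e` is monotone and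
equals `2i` at a zero of `S`, the number `Z` of zeros satisfies `2Z ≤ |E⋆|`, which gives the uniform
bound. In a connected diagram, equality forces `e_i = 2i` for all `i`: every merge absorbs exactly
two edges, that is, contracts a full bubble (`isNestedBubble_of_mergedCount`), and the identity
`2|V⋆| = k + |E⋆|` then gives `k = 2`. In every other case a positive power of `λ_ε` is left over.
For a positive diagram there is no logarithm at all, and the only forest is the empty one. -/

/-! ### Negative powers integrated over balls of the torus. -/

theorem volume_torus_closedBall_le (r : ℝ) (hr : 0 ≤ r) :
    volume (Metric.closedBall (0 : Torus) r) ≤ ENNReal.ofReal (16 * r ^ 4) := by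
  rw [closedBall_pi _ hr, volume_pi_pi]
  calc ∏ i : Fin 4, volume (Metric.closedBall ((0 : Torus) i) r)
      ≤ ∏ _i : Fin 4, ENNReal.ofReal (2 * r) := by
        refine Finset.prod_le_prod' fun i _ => ?_
        rw [AddCircle.volume_closedBall]
        exact ENNReal.ofReal_le_ofReal (min_le_right _ _)
    _ = ENNReal.ofReal (16 * r ^ 4) := by
        rw [Finset.prod_const, Finset.card_univ, Fintype.card_fin,
          ← ENNReal.ofReal_pow (by positivity)]
        congr 1; ring

theorem torus_norm_le (z : Torus) : ‖z‖ ≤ Real.pi := by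
  refine (pi_norm_le_iff_of_nonneg Real.pi_pos.le).2 fun i => ?_
  refine (AddCircle.norm_le_half_period _ Real.two_pi_pos.ne').trans_eq ?_
  rw [abs_of_pos Real.two_pi_pos]; ring

/-- Layer-cake bound for a negative power of `‖z‖ + ε` on a ball. -/
theorem lintegral_ball_layer (ε r : ℝ) (hε : 0 < ε) (hr : 0 ≤ r) (q : ℕ) :
    ∫⁻ z in Metric.closedBall (0 : Torus) r, ENNReal.ofReal (((‖z‖ + ε) ^ q)⁻¹) ≤
      ENNReal.ofReal (((r + ε) ^ q)⁻¹ * (16 * r ^ 4)) +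
        ∫⁻ s in Ioc 0 r, ENNReal.ofReal (16 * q * ((s + ε) ^ (q + 1))⁻¹ * s ^ 4) := by
  have key : ∀ z ∈ Metric.closedBall (0 : Torus) r, ENNReal.ofReal (((‖z‖ + ε) ^ q)⁻¹) ≤
      ENNReal.ofReal (((r + ε) ^ q)⁻¹) + ∫⁻ s in Ioc 0 r,
        (Metric.closedBall (0 : Torus) s).indicator
          (fun _ => ENNReal.ofReal (q * ((s + ε) ^ (q + 1))⁻¹)) z := by
    intro z hz
    have hzr : ‖z‖ ≤ r := by simpa using hz
    set a := ‖z‖ with ha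
    have ha0 : 0 ≤ a := norm_nonneg z
    have hderiv : ∀ s ∈ uIcc a r, HasDerivAt (fun s : ℝ => -((s + ε) ^ q)⁻¹)
        (q * ((s + ε) ^ (q + 1))⁻¹) s := by
      intro s hs
      rw [uIcc_of_le hzr] at hs
      have hpos : 0 < s + ε := by linarith [hs.1]
      have h1 : HasDerivAt (fun s : ℝ => (s + ε) ^ q) (q * (s + ε) ^ (q - 1) * 1) s :=
        ((hasDerivAt_id s).add_const ε).pow q
      have h2 := (h1.inv (pow_ne_zero _ hpos.ne')).neg
      refine h2.congr_deriv ?_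
      rcases q with _ | q
      · simp
      · simp only [Nat.add_sub_cancel]
        field_simp
        ring
    have hcont : ContinuousOn (fun s : ℝ => (q : ℝ) * ((s + ε) ^ (q + 1))⁻¹) (uIcc a r) := by
      intro s hs
      rw [uIcc_of_le hzr] at hs
      have hpos : 0 < s + ε := by linarith [hs.1]
      refine ContinuousAt.continuousWithinAt ?_
      have : (s + ε) ^ (q + 1) ≠ 0 := pow_ne_zero _ hpos.ne'
      fun_prop (disch := assumption)
    have hint := hcont.intervalIntegrable (μ := volume)
    have hftc := intervalIntegral.integral_eq_sub_of_hasDerivAt hderiv hint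
    rw [intervalIntegral.integral_of_le hzr] at hftc
    -- The integrand becomes its value at radius `r` plus an integral over the radii `s` between
    -- `‖z‖` and `r`. Tonelli then leaves only volumes of balls of radius `s`.
    have hval : ((a + ε) ^ q)⁻¹ = ((r + ε) ^ q)⁻¹ +
        ∫ s in Ioc a r, (q : ℝ) * ((s + ε) ^ (q + 1))⁻¹ := by rw [hftc]; ring
    rw [hval]
    refine ENNReal.ofReal_add_le.trans (add_le_add le_rfl ?_)
    rw [ofReal_integral_eq_lintegral_ofReal]
    · have : Ioc a r ⊆ Ioc 0 r := Ioc_subset_Ioc_left ha0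
      refine le_trans (setLIntegral_mono' measurableSet_Ioc ?_) (lintegral_mono_set this)
      intro s hs
      rw [indicator_of_mem]
      simpa [← ha] using hs.1.le
    · exact (intervalIntegrable_iff_integrableOn_Ioc_of_le hzr).1 hint
    · refine (ae_restrict_iff' measurableSet_Ioc).2 (Filter.Eventually.of_forall fun s hs => ?_)
      have hpos : 0 < s + ε := by linarith [hs.1]
      positivity
  refine (setLIntegral_mono' Metric.isClosed_closedBall.measurableSet key).trans ?_
  rw [lintegral_add_left measurable_const]
  refine add_le_add ?_ ?_
  · rw [setLIntegral_const, ENNReal.ofReal_mul (by positivity)]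
    gcongr
    exact volume_torus_closedBall_le r hr
  · rw [lintegral_lintegral_swap]
    · refine setLIntegral_mono' measurableSet_Ioc fun s hs => ?_
      have hpos : 0 < s + ε := by linarith [hs.1]
      refine (lintegral_mono' Measure.restrict_le_self le_rfl).trans ?_
      rw [lintegral_indicator_const Metric.isClosed_closedBall.measurableSet]
      refine (mul_le_mul_right (volume_torus_closedBall_le s hs.1.le) _).trans ?_
      rw [← ENNReal.ofReal_mul (by positivity)]
      exact ENNReal.ofReal_le_ofReal (by ring_nf; rfl)
    · refine Measurable.aemeasurable ?_
      have hset : MeasurableSet {p : Torus × ℝ | ‖p.1‖ ≤ p.2} :=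
        measurableSet_le (by fun_prop) (by fun_prop)
      have : (Function.uncurry fun (z : Torus) (s : ℝ) =>
          (Metric.closedBall (0 : Torus) s).indicator
          (fun _ => ENNReal.ofReal (q * ((s + ε) ^ (q + 1))⁻¹)) z) =
          {p : Torus × ℝ | ‖p.1‖ ≤ p.2}.indicator
            (fun p => ENNReal.ofReal (q * ((p.2 + ε) ^ (q + 1))⁻¹)) := by
        ext ⟨z, s⟩
        simp [Function.uncurry, indicator]
      rw [this]
      refine Measurable.indicator ?_ hset
      fun_prop

/-- The logarithm that is lost in each degree zero scale. -/
noncomputable def logFactor (ε : ℝ) : ℝ := 1 + Real.log (1 / ε)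

theorem one_le_logFactor {ε : ℝ} (hε : 0 < ε) (hε1 : ε < 1) : 1 ≤ logFactor ε := by
  have : 0 ≤ Real.log (1 / ε) := Real.log_nonneg (by rw [le_div_iff₀ hε]; linarith)
  unfold logFactor; linarith

/-- This is one scale of the power counting, in dimension four. For `S ≥ 4` the integrand is
bounded; for `0 < S < 4` the radial integral is that of `(s + ε)^(S-1)`; for `S = 0` it is that of
`(s + ε)⁻¹`, which is where logarithms come from. -/
theorem lintegral_ball_pow_le (ε r : ℝ) (hε : 0 < ε) (hε1 : ε < 1) (hr : 0 ≤ r)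
    (hr4 : r ≤ 4) (S : ℕ) :
    ∫⁻ z in Metric.closedBall (0 : Torus) r, ENNReal.ofReal ((‖z‖ + ε) ^ ((S : ℤ) - 4)) ≤
      ENNReal.ofReal (400 * (r + ε) ^ S * (if S = 0 then logFactor ε else 1)) := by
  have hlf := one_le_logFactor hε hε1
  have hrε : 0 < r + ε := by linarith
  by_cases hS : 4 ≤ S
  · obtain ⟨p, rfl⟩ := Nat.exists_eq_add_of_le hS
    have : ∀ z ∈ Metric.closedBall (0 : Torus) r,
        ENNReal.ofReal ((‖z‖ + ε) ^ (((4 + p : ℕ) : ℤ) - 4)) ≤ ENNReal.ofReal ((r + ε) ^ p) := by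
      intro z hz
      have hz' : ‖z‖ ≤ r := by simpa using hz
      have h0 := norm_nonneg z
      rw [show (((4 + p : ℕ) : ℤ) - 4) = (p : ℤ) by push_cast; ring, zpow_natCast]
      exact ENNReal.ofReal_le_ofReal (pow_le_pow_left₀ (by linarith) (by linarith) _)
    refine (setLIntegral_mono' Metric.isClosed_closedBall.measurableSet this).trans ?_
    rw [setLIntegral_const]
    refine (mul_le_mul_right (volume_torus_closedBall_le r hr) _).trans ?_
    rw [← ENNReal.ofReal_mul (by positivity)]
    refine ENNReal.ofReal_le_ofReal ?_
    rw [if_neg (by omega), mul_one, pow_add]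
    have : r ^ 4 ≤ (r + ε) ^ 4 := pow_le_pow_left₀ hr (by linarith) _
    have h2 : 0 ≤ (r + ε) ^ p := by positivity
    have h3 : 0 ≤ (r + ε) ^ 4 := by positivity
    nlinarith [mul_le_mul_of_nonneg_left this h2, mul_nonneg h2 h3]
  · push Not at hS
    obtain ⟨q, hq⟩ : ∃ q : ℕ, S + q = 4 := ⟨4 - S, by omega⟩
    have hq1 : 1 ≤ q := by omega
    have e1 : ∀ z : Torus, (‖z‖ + ε) ^ ((S : ℤ) - 4) = ((‖z‖ + ε) ^ q)⁻¹ := by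
      intro z
      rw [show (S : ℤ) - 4 = -(q : ℤ) by omega, zpow_neg, zpow_natCast]
    simp_rw [e1]
    refine (lintegral_ball_layer ε r hε hr q).trans ?_
    have h1 : ((r + ε) ^ q)⁻¹ * (16 * r ^ 4) ≤ 16 * (r + ε) ^ S := by
      rw [inv_mul_le_iff₀ (by positivity)]
      have : r ^ 4 ≤ (r + ε) ^ 4 := pow_le_pow_left₀ hr (by linarith) _
      calc 16 * r ^ 4 ≤ 16 * (r + ε) ^ 4 := by linarith
        _ = (r + ε) ^ q * (16 * (r + ε) ^ S) := by rw [← hq, pow_add]; ring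
    by_cases hS0 : S = 0
    · subst hS0
      obtain rfl : q = 4 := by omega
      have h2 : ∫⁻ s in Ioc 0 r, ENNReal.ofReal (16 * (4 : ℕ) * ((s + ε) ^ (4 + 1))⁻¹ * s ^ 4) ≤
          ENNReal.ofReal (64 * Real.log ((r + ε) / ε)) := by
        have hint : IntervalIntegrable (fun s : ℝ => (s + ε)⁻¹) volume 0 r := by
          refine ContinuousOn.intervalIntegrable ?_
          intro s hs
          rw [uIcc_of_le hr] at hs
          have hpos : s + ε ≠ 0 := by linarith [hs.1]
          refine ContinuousAt.continuousWithinAt ?_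
          fun_prop (disch := assumption)
        have hint' := (intervalIntegrable_iff_integrableOn_Ioc_of_le hr).1 hint
        have : ∫ s in (0 : ℝ)..r, (s + ε)⁻¹ = Real.log ((r + ε) / ε) := by
          rw [intervalIntegral.integral_comp_add_right (fun s => s⁻¹), zero_add,
            integral_inv_of_pos hε hrε]
        rw [← this, intervalIntegral.integral_of_le hr, ← integral_const_mul,
          ofReal_integral_eq_lintegral_ofReal]
        · refine setLIntegral_mono' measurableSet_Ioc fun s hs => ENNReal.ofReal_le_ofReal ?_
          have hpos : 0 < s + ε := by linarith [hs.1]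
          have : s ^ 4 ≤ (s + ε) ^ 4 := pow_le_pow_left₀ hs.1.le (by linarith) _
          calc 16 * ((4 : ℕ) : ℝ) * ((s + ε) ^ (4 + 1))⁻¹ * s ^ 4
              ≤ 16 * ((4 : ℕ) : ℝ) * ((s + ε) ^ (4 + 1))⁻¹ * (s + ε) ^ 4 := by gcongr
            _ = 64 * (s + ε)⁻¹ := by field_simp; norm_num; ring
        · exact hint'.const_mul _
        · refine (ae_restrict_iff' measurableSet_Ioc).2 (Filter.Eventually.of_forall fun s hs => ?_)
          have hpos : 0 < s + ε := by linarith [hs.1]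
          positivity
      refine (add_le_add (ENNReal.ofReal_le_ofReal h1) h2).trans ?_
      have hlog0 : 0 ≤ Real.log ((r + ε) / ε) :=
        Real.log_nonneg (by rw [le_div_iff₀ hε]; linarith)
      rw [← ENNReal.ofReal_add (by positivity) (by positivity)]
      refine ENNReal.ofReal_le_ofReal ?_
      -- The restriction `r ≤ 4` is needed here: `log (r + ε) ≤ r + ε - 1 ≤ 4`.
      have h5 : Real.log ((r + ε) / ε) ≤ 4 + Real.log (1 / ε) := by
        rw [Real.log_div hrε.ne' hε.ne', one_div, Real.log_inv]
        have := Real.log_le_sub_one_of_pos hrε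
        linarith
      simp only [pow_zero, if_true]
      unfold logFactor at *
      linarith
    · have h2 : ∫⁻ s in Ioc 0 r, ENNReal.ofReal (16 * q * ((s + ε) ^ (q + 1))⁻¹ * s ^ 4) ≤
          ENNReal.ofReal (64 * (r + ε) ^ S) := by
        have : ∀ s ∈ Ioc 0 r, ENNReal.ofReal (16 * q * ((s + ε) ^ (q + 1))⁻¹ * s ^ 4) ≤
            ENNReal.ofReal (64 * (r + ε) ^ (S - 1)) := by
          intro s hs
          have hpos : 0 < s + ε := by linarith [hs.1]
          refine ENNReal.ofReal_le_ofReal ?_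
          have h6 : s ^ 4 ≤ (s + ε) ^ 4 := pow_le_pow_left₀ hs.1.le (by linarith) _
          have h7 : (s + ε) ^ (S - 1) ≤ (r + ε) ^ (S - 1) :=
            pow_le_pow_left₀ hpos.le (by linarith [hs.2]) _
          have h8 : (q : ℝ) ≤ 4 := by exact_mod_cast (by omega : q ≤ 4)
          calc 16 * (q : ℝ) * ((s + ε) ^ (q + 1))⁻¹ * s ^ 4
              ≤ 16 * 4 * ((s + ε) ^ (q + 1))⁻¹ * (s + ε) ^ 4 := by gcongr
            _ = 64 * (s + ε) ^ (S - 1) := by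
                rw [show 4 = (q + 1) + (S - 1) by omega, pow_add]
                field_simp
                norm_num
                ring
            _ ≤ _ := by linarith
        refine (setLIntegral_mono' measurableSet_Ioc this).trans ?_
        rw [setLIntegral_const, Real.volume_Ioc, ← ENNReal.ofReal_mul (by positivity)]
        refine ENNReal.ofReal_le_ofReal ?_
        obtain ⟨S', rfl⟩ : ∃ S', S = S' + 1 := ⟨S - 1, by omega⟩
        simp only [Nat.add_sub_cancel]
        have h9 : 0 ≤ (r + ε) ^ S' := by positivity
        rw [pow_succ]
        nlinarith
      refine (add_le_add (ENNReal.ofReal_le_ofReal h1) h2).trans ?_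
      rw [← ENNReal.ofReal_add (by positivity) (by positivity)]
      refine ENNReal.ofReal_le_ofReal ?_
      rw [if_neg hS0]
      have : 0 ≤ (r + ε) ^ S := by positivity
      linarith

/-! ### Nested integrals over points ordered by norm. -/

/-- The number of scales `i < N` at which the degree `S (i + 1)` vanishes. -/
def numZeros (S : ℕ → ℕ) (N : ℕ) : ℕ := ((Finset.range N).filter fun i => S (i + 1) = 0).card

theorem numZeros_succ (S : ℕ → ℕ) (N : ℕ) :
    numZeros S (N + 1) = numZeros S N + if S (N + 1) = 0 then 1 else 0 := by
  unfold numZeros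
  rw [Finset.range_add_one, Finset.filter_insert]
  split_ifs with h
  · rw [Finset.card_insert_of_notMem (by simp)]
  · simp

/-- Families of points whose norms are increasing and at most `r`. -/
def orderedSet (N : ℕ) (r : ℝ) : Set (Fin N → Torus) :=
  {z | (∀ i j, i ≤ j → ‖z i‖ ≤ ‖z j‖) ∧ ∀ i, ‖z i‖ ≤ r}

theorem measurableSet_orderedSet (N : ℕ) (r : ℝ) : MeasurableSet (orderedSet N r) := by
  have : orderedSet N r = (⋂ i, ⋂ j, ⋂ _ : i ≤ j, {z : Fin N → Torus | ‖z i‖ ≤ ‖z j‖}) ∩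
      ⋂ i, {z : Fin N → Torus | ‖z i‖ ≤ r} := by
    ext z; simp [orderedSet]
  rw [this]
  refine MeasurableSet.inter ?_ ?_
  · refine MeasurableSet.iInter fun i => MeasurableSet.iInter fun j => MeasurableSet.iInter fun _ =>
      measurableSet_le (by fun_prop) (by fun_prop)
  · exact MeasurableSet.iInter fun i => measurableSet_le (by fun_prop) (by fun_prop)

/-- Each new point gains 4 from its volume element and loses `2 c i` from the edges of that length,
which is the recursion for `S`. The point of largest norm is kept outermost: the others lie in the
ball of radius `‖x‖`, so induction gives them a power `S N` of `‖x‖ + ε`, and the last integral is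
`lintegral_ball_pow_le` with exponent `S (N + 1) - 4`. -/
theorem lintegral_orderedSet_le (ε : ℝ) (hε : 0 < ε) (hε1 : ε < 1) (c S : ℕ → ℕ) (hS0 : S 0 = 0)
    (N : ℕ) (hS : ∀ i < N, S (i + 1) + 2 * c i = S i + 4) (r : ℝ) (hr : 0 ≤ r) (hr4 : r ≤ 4) :
    ∫⁻ z : Fin N → Torus, (orderedSet N r).indicator
        (fun z => ∏ i, ENNReal.ofReal ((‖z i‖ + ε) ^ (-(2 * c i : ℕ) : ℤ))) z ≤
      ENNReal.ofReal (400 ^ N * (r + ε) ^ S N * logFactor ε ^ numZeros S N) := by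
  have hlf := one_le_logFactor hε hε1
  induction N generalizing r with
  | zero =>
    have h1 : ∀ z : Fin 0 → Torus, z ∈ orderedSet 0 r := fun z => by simp [orderedSet]
    simp [hS0, numZeros, h1, volume_pi]
  | succ N ih =>
    have hm := volume_preserving_piFinSuccAbove (fun _ : Fin (N + 1) => Torus) (Fin.last N)
    have hmeas : ∀ (N : ℕ), Measurable fun z : Fin N → Torus =>
        ∏ i, ENNReal.ofReal ((‖z i‖ + ε) ^ (-(2 * c i : ℕ) : ℤ)) := by
      intro N
      refine Finset.measurable_prod _ fun i _ => ?_
      fun_prop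
    have hfm := (hmeas (N + 1)).indicator (measurableSet_orderedSet (N + 1) r)
    rw [← hm.symm.lintegral_comp hfm, Measure.volume_eq_prod, lintegral_prod]
    swap
    · exact (hfm.comp hm.symm.measurable).aemeasurable
    have hins : ∀ (x : Torus) (z : Fin N → Torus),
        (MeasurableEquiv.piFinSuccAbove (fun _ : Fin (N + 1) => Torus) (Fin.last N)).symm (x, z)
          = Fin.snoc z x := by
      intro x z
      simp only [MeasurableEquiv.piFinSuccAbove_symm_apply]
      exact Fin.insertNth_last' _ _
    have hset : ∀ (x : Torus) (z : Fin N → Torus),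
        (Fin.snoc z x : Fin (N + 1) → Torus) ∈ orderedSet (N + 1) r ↔
          z ∈ orderedSet N ‖x‖ ∧ ‖x‖ ≤ r := by
      intro x z
      constructor
      · rintro ⟨h1, h2⟩
        refine ⟨⟨fun i j hij => ?_, fun i => ?_⟩, ?_⟩
        · simpa using h1 i.castSucc j.castSucc (by simpa using hij)
        · simpa using h1 i.castSucc (Fin.last N) (Fin.le_last _)
        · simpa using h2 (Fin.last N)
      · rintro ⟨⟨h1, h2⟩, h3⟩
        refine ⟨fun i j => ?_, fun i => ?_⟩
        · refine Fin.lastCases ?_ (fun j => ?_) j <;> refine Fin.lastCases ?_ (fun i => ?_) i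
          · simp
          · intro _; simpa using h2 i
          · intro h; exact absurd h (by simp [Fin.le_def])
          · intro h; simpa using h1 i j (by simpa using h)
        · refine Fin.lastCases ?_ (fun i => ?_) i
          · simpa using h3
          · simpa using (h2 i).trans h3
    have hstep : ∀ x : Torus, ∫⁻ z : Fin N → Torus,
        (orderedSet (N + 1) r).indicator
          (fun z => ∏ i, ENNReal.ofReal ((‖z i‖ + ε) ^ (-(2 * c i : ℕ) : ℤ)))
            ((MeasurableEquiv.piFinSuccAbove
              (fun _ : Fin (N + 1) => Torus) (Fin.last N)).symm (x, z)) ≤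
        (Metric.closedBall (0 : Torus) r).indicator (fun x =>
          ENNReal.ofReal (400 ^ N * logFactor ε ^ numZeros S N) *
            ENNReal.ofReal ((‖x‖ + ε) ^ ((S (N + 1) : ℤ) - 4))) x := by
      intro x
      simp_rw [hins]
      have hx0 : 0 < ‖x‖ + ε := by linarith [norm_nonneg x]
      by_cases hx : ‖x‖ ≤ r
      · rw [indicator_of_mem (by simpa using hx)]
        have e2 : ∀ z : Fin N → Torus, (orderedSet (N + 1) r).indicator
            (fun z => ∏ i, ENNReal.ofReal ((‖z i‖ + ε) ^ (-(2 * c i : ℕ) : ℤ))) (Fin.snoc z x) =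
            ENNReal.ofReal ((‖x‖ + ε) ^ (-(2 * c N : ℕ) : ℤ)) * (orderedSet N ‖x‖).indicator
              (fun z => ∏ i, ENNReal.ofReal ((‖z i‖ + ε) ^ (-(2 * c i : ℕ) : ℤ))) z := by
          intro z
          by_cases hz : z ∈ orderedSet N ‖x‖
          · rw [indicator_of_mem ((hset x z).2 ⟨hz, hx⟩), indicator_of_mem hz,
              Fin.prod_univ_castSucc, mul_comm]
            simp
          · rw [indicator_of_notMem (fun h => hz ((hset x z).1 h).1), indicator_of_notMem hz,
              mul_zero]
        -- The induction hypothesis is used at the radius `‖x‖`, which is why `r` is generalised.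
        simp_rw [e2]
        rw [lintegral_const_mul _ ((hmeas N).indicator (measurableSet_orderedSet N _))]
        refine (mul_le_mul_right (ih (fun i hi => hS i (by omega)) ‖x‖ (norm_nonneg x)
          (hx.trans hr4)) _).trans ?_
        rw [← ENNReal.ofReal_mul (by positivity), ← ENNReal.ofReal_mul (by positivity)]
        refine ENNReal.ofReal_le_ofReal (le_of_eq ?_)
        have h5 : (S (N + 1) : ℤ) - 4 = -(2 * c N : ℕ) + (S N : ℕ) := by
          have := hS N (by omega)
          omega
        rw [h5, zpow_add₀ hx0.ne', zpow_natCast]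
        ring
      · have : ∀ z : Fin N → Torus, (Fin.snoc z x : Fin (N + 1) → Torus) ∉ orderedSet (N + 1) r :=
          fun z hz => hx ((hset x z).1 hz).2
        simp [this]
    refine (lintegral_mono hstep).trans ?_
    rw [lintegral_indicator Metric.isClosed_closedBall.measurableSet,
      lintegral_const_mul _ (by fun_prop)]
    refine (mul_le_mul_right (lintegral_ball_pow_le ε r hε hε1 hr hr4 (S (N + 1))) _).trans ?_
    rw [← ENNReal.ofReal_mul (by positivity)]
    refine ENNReal.ofReal_le_ofReal (le_of_eq ?_)
    rw [numZeros_succ]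
    split_ifs <;> ring

/-! ### Pointwise bounds on the mollified Green's function. -/

theorem heatKernel_nonneg (t : ℝ) (u : EuclideanSpace ℝ (Fin 4)) : 0 ≤ heatKernel t u := by
  unfold heatKernel; positivity

theorem measurable_heatKernel :
    Measurable fun p : ℝ × EuclideanSpace ℝ (Fin 4) => heatKernel p.1 p.2 := by
  unfold heatKernel; fun_prop

theorem heatKernel_le {t : ℝ} (ht : 0 < t) (u : EuclideanSpace ℝ (Fin 4)) :
    heatKernel t u ≤ (t ^ 2)⁻¹ * Real.exp (-(‖u‖ ^ 2) / (4 * t)) := by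
  unfold heatKernel
  refine mul_le_mul_of_nonneg_right ?_ (Real.exp_nonneg _)
  rw [one_div]
  refine inv_anti₀ (by positivity) (pow_le_pow_left₀ ht.le ?_ 2)
  nlinarith [Real.pi_gt_three]

theorem lintegral_heatKernel {t : ℝ} (ht : 0 < t) :
    ∫⁻ u, ENNReal.ofReal (heatKernel t u) = 1 := by
  have hb : 0 < 1 / (4 * t) := by positivity
  have h := GaussianFourier.integral_rexp_neg_mul_sq_norm (V := EuclideanSpace ℝ (Fin 4)) hb
  have hint : ∫ u, heatKernel t u = 1 := by
    unfold heatKernel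
    rw [integral_const_mul]
    have e : ∀ u : EuclideanSpace ℝ (Fin 4), -(‖u‖ ^ 2) / (4 * t) = -(1 / (4 * t)) * ‖u‖ ^ 2 := by
      intro u; ring
    simp_rw [e]
    rw [h, finrank_euclideanSpace_fin]
    norm_num
    field_simp
  rw [← ofReal_integral_eq_lintegral_ofReal]
  · rw [hint, ENNReal.ofReal_one]
  -- Integrability comes for free: a non-integrable function has Bochner integral zero, not one.
  · by_contra hn
    rw [integral_undef hn] at hint
    exact zero_ne_one hint
  · exact Filter.Eventually.of_forall fun u => heatKernel_nonneg t u

/-- Split the time integral at `t = a ^ 2`, where the two bounds agree. Every estimate on the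
Green's function below is an instance, `a` being the length at which the heat kernel stops growing
as `t` decreases, or simply 1. -/
theorem lintegral_Ioi_le_of_le_of_le (f : ℝ → ENNReal) (A a : ℝ) (hA : 0 < A) (ha : 0 < a)
    (h1 : ∀ t, 0 < t → f t ≤ ENNReal.ofReal (A * (t ^ 2)⁻¹))
    (h2 : ∀ t, 0 < t → f t ≤ ENNReal.ofReal (A * (a ^ 4)⁻¹)) :
    ∫⁻ t in Ioi 0, f t ≤ ENNReal.ofReal (2 * A * (a ^ 2)⁻¹) := by
  have hu : Ioi (0 : ℝ) = Ioc 0 (a ^ 2) ∪ Ioi (a ^ 2) := by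
    rw [Ioc_union_Ioi_eq_Ioi (by positivity)]
  rw [hu]
  refine (lintegral_union_le _ _ _).trans ?_
  have e1 : ∫⁻ t in Ioc 0 (a ^ 2), f t ≤ ENNReal.ofReal (A * (a ^ 2)⁻¹) := by
    refine (setLIntegral_mono' measurableSet_Ioc fun t ht => h2 t ht.1).trans ?_
    rw [setLIntegral_const, Real.volume_Ioc, ← ENNReal.ofReal_mul (by positivity)]
    refine ENNReal.ofReal_le_ofReal (le_of_eq ?_)
    field_simp
    ring
  have e2 : ∫⁻ t in Ioi (a ^ 2), f t ≤ ENNReal.ofReal (A * (a ^ 2)⁻¹) := by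
    have ha2 : 0 < a ^ 2 := by positivity
    refine (setLIntegral_mono' measurableSet_Ioi fun t ht => h1 t (ha2.trans ht)).trans ?_
    have hi := integrableOn_Ioi_rpow_of_lt (a := -2) (c := a ^ 2) (by norm_num) ha2
    have hv := integral_Ioi_rpow_of_lt (a := -2) (c := a ^ 2) (by norm_num) ha2
    have e : ∀ t ∈ Ioi (a ^ 2), ENNReal.ofReal (A * (t ^ 2)⁻¹) =
        ENNReal.ofReal (A * t ^ (-2 : ℝ)) := by
      intro t ht
      have : 0 < t := ha2.trans ht
      rw [Real.rpow_neg this.le]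
      norm_num
    rw [setLIntegral_congr_fun measurableSet_Ioi e, ← ofReal_integral_eq_lintegral_ofReal,
      integral_const_mul, hv]
    · refine ENNReal.ofReal_le_ofReal (le_of_eq ?_)
      have : (a ^ 2) ^ ((-2 : ℝ) + 1) = (a ^ 2)⁻¹ := by
        rw [show (-2 : ℝ) + 1 = -1 by norm_num, Real.rpow_neg_one]
      rw [this]; ring
    · exact hi.const_mul _
    · refine (ae_restrict_iff' measurableSet_Ioi).2 (Filter.Eventually.of_forall fun t ht => ?_)
      have : 0 < t := ha2.trans ht
      positivity
  refine (add_le_add e1 e2).trans ?_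
  rw [← ENNReal.ofReal_add (by positivity) (by positivity)]
  exact ENNReal.ofReal_le_ofReal (by linarith)

/-- The heat kernel on `ℝ⁴`, mollified at scale `ε`. -/
noncomputable def mollHeat (ρ : EuclideanSpace ℝ (Fin 4) → ℝ) (ε t : ℝ)
    (u : EuclideanSpace ℝ (Fin 4)) : ENNReal :=
  ∫⁻ y, ENNReal.ofReal ((ε ^ 4)⁻¹ * ρ (ε⁻¹ • y)) * ENNReal.ofReal (heatKernel t (u - y))

/-- The Green's function of `1 - Δ` on `ℝ⁴`, mollified at scale `ε`. -/
noncomputable def mollGreen (ρ : EuclideanSpace ℝ (Fin 4) → ℝ) (ε : ℝ)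
    (u : EuclideanSpace ℝ (Fin 4)) : ENNReal :=
  ∫⁻ t in Ioi (0 : ℝ), ENNReal.ofReal (Real.exp (-t)) * mollHeat ρ ε t u

theorem IsMollifier.lintegral_eq_one
    {ρ : EuclideanSpace ℝ (Fin 4) → ℝ} (hρ : IsMollifier ρ) {ε : ℝ} (hε : 0 < ε) :
    ∫⁻ y, ENNReal.ofReal ((ε ^ 4)⁻¹ * ρ (ε⁻¹ • y)) = 1 := by
  have hint : ∫ y, (ε ^ 4)⁻¹ * ρ (ε⁻¹ • y) = 1 := by
    rw [integral_const_mul, Measure.integral_comp_smul, hρ.mass_one, finrank_euclideanSpace_fin]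
    rw [inv_pow, inv_inv, abs_of_pos (by positivity)]
    simp only [smul_eq_mul, mul_one]
    field_simp
  rw [← ofReal_integral_eq_lintegral_ofReal]
  · rw [hint, ENNReal.ofReal_one]
  · by_contra hn
    rw [integral_undef hn] at hint
    exact zero_ne_one hint
  · exact Filter.Eventually.of_forall fun u => mul_nonneg (by positivity) (hρ.nonneg _)

theorem IsMollifier.measurable
    {ρ : EuclideanSpace ℝ (Fin 4) → ℝ} (hρ : IsMollifier ρ) : Measurable ρ := hρ.smooth.continuous.measurable

theorem IsMollifier.exists_bound
    {ρ : EuclideanSpace ℝ (Fin 4) → ℝ} (hρ : IsMollifier ρ) : ∃ M : ℝ, 1 ≤ M ∧ ∀ y, ρ y ≤ M := by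
  obtain ⟨M, hM⟩ := hρ.compact_support.exists_bound_of_continuous hρ.smooth.continuous
  exact ⟨max M 1, le_max_right _ _, fun y => (le_abs_self _).trans ((hM y).trans (le_max_left _ _))⟩

theorem IsMollifier.exists_radius
    {ρ : EuclideanSpace ℝ (Fin 4) → ℝ} (hρ : IsMollifier ρ) : ∃ R : ℝ, 1 ≤ R ∧ ∀ y, ρ y ≠ 0 → ‖y‖ ≤ R := by
  obtain ⟨R, hR⟩ := hρ.compact_support.isCompact.isBounded.exists_norm_le
  exact ⟨max R 1, le_max_right _ _, fun y hy =>
    (hR y (subset_tsupport _ hy)).trans (le_max_left _ _)⟩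

theorem mollHeat_le_of_heatKernel_le
    {ρ : EuclideanSpace ℝ (Fin 4) → ℝ} (hρ : IsMollifier ρ) {ε t B : ℝ} (hε : 0 < ε) (u : EuclideanSpace ℝ (Fin 4))
    (h : ∀ y, ρ (ε⁻¹ • y) ≠ 0 → heatKernel t (u - y) ≤ B) :
    mollHeat ρ ε t u ≤ ENNReal.ofReal B := by
  have hm : Measurable fun y => ENNReal.ofReal ((ε ^ 4)⁻¹ * ρ (ε⁻¹ • y)) := by
    have := hρ.measurable
    fun_prop
  calc mollHeat ρ ε t u
      ≤ ∫⁻ y, ENNReal.ofReal ((ε ^ 4)⁻¹ * ρ (ε⁻¹ • y)) * ENNReal.ofReal B := by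
        refine lintegral_mono fun y => ?_
        by_cases hy : ρ (ε⁻¹ • y) = 0
        · simp [hy]
        · exact mul_le_mul_right (ENNReal.ofReal_le_ofReal (h y hy)) _
    _ = ENNReal.ofReal B := by
        rw [lintegral_mul_const _ hm, hρ.lintegral_eq_one hε, one_mul]

theorem mollHeat_le_inv_sq
    {ρ : EuclideanSpace ℝ (Fin 4) → ℝ} (hρ : IsMollifier ρ) {ε t : ℝ} (hε : 0 < ε) (ht : 0 < t) (u : EuclideanSpace ℝ (Fin 4)) :
    mollHeat ρ ε t u ≤ ENNReal.ofReal (t ^ 2)⁻¹ := by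
  refine mollHeat_le_of_heatKernel_le hρ hε u fun y _ => (heatKernel_le ht _).trans ?_
  refine mul_le_of_le_one_right (by positivity) (Real.exp_le_one_iff.2 ?_)
  exact div_nonpos_of_nonpos_of_nonneg (by simp) (by positivity)

/-- The roles in the convolution are exchanged: here the heat kernel is the probability density and
the mollifier is bounded by its supremum, so that small times cause no singularity. -/
theorem mollHeat_le_sup
    {ρ : EuclideanSpace ℝ (Fin 4) → ℝ} {ε t M : ℝ} (hε : 0 < ε) (ht : 0 < t) (hM : ∀ y, ρ y ≤ M)
    (u : EuclideanSpace ℝ (Fin 4)) :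
    mollHeat ρ ε t u ≤ ENNReal.ofReal (M * (ε ^ 4)⁻¹) := by
  have hm : Measurable fun y => ENNReal.ofReal (heatKernel t (u - y)) := by
    have := measurable_heatKernel
    exact ENNReal.measurable_ofReal.comp (this.comp (by fun_prop : Measurable fun y => (t, u - y)))
  calc mollHeat ρ ε t u
      ≤ ∫⁻ y, ENNReal.ofReal (M * (ε ^ 4)⁻¹) * ENNReal.ofReal (heatKernel t (u - y)) := by
        refine lintegral_mono fun y => mul_le_mul_left (ENNReal.ofReal_le_ofReal ?_) _
        rw [mul_comm]
        exact mul_le_mul_of_nonneg_right (hM _) (by positivity)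
    _ = ENNReal.ofReal (M * (ε ^ 4)⁻¹) := by
        rw [lintegral_const_mul _ hm,
          lintegral_sub_left_eq_self (fun y => ENNReal.ofReal (heatKernel t y)) u,
          lintegral_heatKernel ht, mul_one]

/-- At distance at least `2Rε` the mollifier moves the point by at most half its norm, so the
Gaussian survives with a quarter of its exponent. -/
theorem mollHeat_le_exp
    {ρ : EuclideanSpace ℝ (Fin 4) → ℝ} (hρ : IsMollifier ρ) {ε t R : ℝ} (hε : 0 < ε) (ht : 0 < t) (hR : ∀ y, ρ y ≠ 0 → ‖y‖ ≤ R)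
    (u : EuclideanSpace ℝ (Fin 4)) (hu : 2 * R * ε ≤ ‖u‖) :
    mollHeat ρ ε t u ≤ ENNReal.ofReal ((t ^ 2)⁻¹ * Real.exp (-(‖u‖ ^ 2 / (16 * t)))) := by
  refine mollHeat_le_of_heatKernel_le hρ hε u fun y hy => (heatKernel_le ht _).trans ?_
  have h1 := hR _ hy
  rw [norm_smul, norm_inv, Real.norm_of_nonneg hε.le, inv_mul_le_iff₀ hε] at h1
  have h2 : ‖u‖ / 2 ≤ ‖u - y‖ := by
    have := norm_sub_norm_le u y
    nlinarith
  refine mul_le_mul_of_nonneg_left (Real.exp_le_exp.2 ?_) (by positivity)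
  rw [neg_div, neg_le_neg_iff, div_le_div_iff₀ (by positivity) (by positivity)]
  have h3 : (‖u‖ / 2) ^ 2 ≤ ‖u - y‖ ^ 2 := pow_le_pow_left₀ (by positivity) h2 2
  nlinarith

theorem exp_neg_mul_mollHeat_le
    {ρ : EuclideanSpace ℝ (Fin 4) → ℝ} {ε t : ℝ} (ht : 0 < t) (u : EuclideanSpace ℝ (Fin 4)) :
    ENNReal.ofReal (Real.exp (-t)) * mollHeat ρ ε t u ≤ mollHeat ρ ε t u := by
  refine mul_le_of_le_one_left zero_le ?_
  rw [← ENNReal.ofReal_one]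
  exact ENNReal.ofReal_le_ofReal (Real.exp_le_one_iff.2 (by linarith))

theorem exp_neg_le_factorial_div {x : ℝ} (hx : 0 < x) (k : ℕ) :
    Real.exp (-x) ≤ k.factorial / x ^ k := by
  rw [Real.exp_neg, inv_le_comm₀ (Real.exp_pos _) (by positivity), inv_div]
  exact Real.pow_div_factorial_le_exp x hx.le k

theorem mollGreen_le_eps
    {ρ : EuclideanSpace ℝ (Fin 4) → ℝ} (hρ : IsMollifier ρ) {ε M : ℝ} (hε : 0 < ε) (hM1 : 1 ≤ M) (hM : ∀ y, ρ y ≤ M)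
    (u : EuclideanSpace ℝ (Fin 4)) :
    mollGreen ρ ε u ≤ ENNReal.ofReal (2 * M * (ε ^ 2)⁻¹) := by
  refine lintegral_Ioi_le_of_le_of_le _ M ε (by linarith) hε (fun t ht => ?_) fun t ht => ?_
  · refine (exp_neg_mul_mollHeat_le ht u).trans ((mollHeat_le_inv_sq hρ hε ht u).trans ?_)
    exact ENNReal.ofReal_le_ofReal (le_mul_of_one_le_left (by positivity) hM1)
  · exact (exp_neg_mul_mollHeat_le ht u).trans (mollHeat_le_sup hε ht hM u)

theorem mollGreen_le_of_far
    {ρ : EuclideanSpace ℝ (Fin 4) → ℝ} (hρ : IsMollifier ρ) {ε R : ℝ} (hε : 0 < ε) (hR1 : 1 ≤ R)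
    (hR : ∀ y, ρ y ≠ 0 → ‖y‖ ≤ R) (u : EuclideanSpace ℝ (Fin 4)) (hu : 2 * R * ε ≤ ‖u‖) :
    mollGreen ρ ε u ≤ ENNReal.ofReal (2 * 512 * (‖u‖ ^ 2)⁻¹) := by
  have hu0 : 0 < ‖u‖ := lt_of_lt_of_le (by positivity) hu
  refine lintegral_Ioi_le_of_le_of_le _ 512 ‖u‖ (by norm_num) hu0 (fun t ht => ?_) fun t ht => ?_
  · refine (exp_neg_mul_mollHeat_le ht u).trans ((mollHeat_le_inv_sq hρ hε ht u).trans ?_)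
    exact ENNReal.ofReal_le_ofReal (le_mul_of_one_le_left (by positivity) (by norm_num))
  · refine (exp_neg_mul_mollHeat_le ht u).trans ((mollHeat_le_exp hρ hε ht hR u hu).trans ?_)
    refine ENNReal.ofReal_le_ofReal ?_
    refine (mul_le_mul_of_nonneg_left (exp_neg_le_factorial_div
      (x := ‖u‖ ^ 2 / (16 * t)) (by positivity) 2) (by positivity)).trans (le_of_eq ?_)
    simp only [Nat.factorial]
    field_simp
    norm_num

/-- The mass term `e^{-t}` controls large times and the Gaussian controls small ones, so any power
of decay is available. The power 8 suffices to dominate `∏ i, (1 + n i ^ 2)⁻¹` on the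
four-dimensional lattice. -/
theorem mollGreen_le_decay
    {ρ : EuclideanSpace ℝ (Fin 4) → ℝ} (hρ : IsMollifier ρ) {ε R : ℝ} (hε : 0 < ε) (hR1 : 1 ≤ R)
    (hR : ∀ y, ρ y ≠ 0 → ‖y‖ ≤ R) (u : EuclideanSpace ℝ (Fin 4)) (hu : 2 * R * ε ≤ ‖u‖) :
    mollGreen ρ ε u ≤ ENNReal.ofReal (2 * (24 * 24 * 16 ^ 4) * (‖u‖ ^ 8)⁻¹) := by
  have hu0 : 0 < ‖u‖ := lt_of_lt_of_le (by positivity) hu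
  have key : ∀ t, 0 < t → ∀ k : ℕ, ENNReal.ofReal (Real.exp (-t)) * mollHeat ρ ε t u ≤
      ENNReal.ofReal (k.factorial / t ^ k * ((t ^ 2)⁻¹ * (24 / (‖u‖ ^ 2 / (16 * t)) ^ 4))) := by
    intro t ht k
    refine (mul_le_mul_right (mollHeat_le_exp hρ hε ht hR u hu) _).trans ?_
    rw [← ENNReal.ofReal_mul (by positivity)]
    refine ENNReal.ofReal_le_ofReal ?_
    have h1 := exp_neg_le_factorial_div ht k
    have h2 := exp_neg_le_factorial_div (x := ‖u‖ ^ 2 / (16 * t)) (by positivity) 4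
    have h3 : ((Nat.factorial 4 : ℕ) : ℝ) = 24 := by norm_num [Nat.factorial]
    rw [h3] at h2
    gcongr
  have hA : (2 * (24 * 24 * 16 ^ 4) * (‖u‖ ^ 8)⁻¹ : ℝ) =
      2 * (24 * 24 * 16 ^ 4 * (‖u‖ ^ 8)⁻¹) * (1 ^ 2)⁻¹ := by ring
  rw [hA]
  -- The Gaussian contributes `t ^ 4 * (t ^ 2)⁻¹`. Bounding `e^{-t}` by `4! / t ^ 4` leaves `t⁻²`,
  -- and by `2! / t ^ 2` leaves a constant.
  refine lintegral_Ioi_le_of_le_of_le _ _ 1 (by positivity) one_pos (fun t ht => ?_) fun t ht => ?_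
  · refine (key t ht 4).trans (ENNReal.ofReal_le_ofReal (le_of_eq ?_))
    have h3 : ((Nat.factorial 4 : ℕ) : ℝ) = 24 := by norm_num [Nat.factorial]
    rw [h3]
    field_simp
  · refine (key t ht 2).trans (ENNReal.ofReal_le_ofReal ?_)
    have h3 : ((Nat.factorial 2 : ℕ) : ℝ) = 2 := by norm_num [Nat.factorial]
    rw [h3]
    have : 2 / t ^ 2 * ((t ^ 2)⁻¹ * (24 / (‖u‖ ^ 2 / (16 * t)) ^ 4)) =
      2 * 24 * 16 ^ 4 * (‖u‖ ^ 8)⁻¹ := by field_simp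
    rw [this]
    have : 0 ≤ (‖u‖ ^ 8)⁻¹ := by positivity
    norm_num
    linarith

/-- Beyond distance `2Rε` the kernel behaves like the unmollified one and `‖u‖ + ε` is comparable to
`‖u‖`; within it the bound `ε⁻²` takes over and `‖u‖ + ε` is at most a multiple of `ε`. -/
theorem exists_mollGreen_le
    {ρ : EuclideanSpace ℝ (Fin 4) → ℝ} (hρ : IsMollifier ρ) : ∃ C : ℝ, 0 < C ∧ ∀ ε : ℝ, 0 < ε → ε < 1 →
    ∀ u : EuclideanSpace ℝ (Fin 4),
      mollGreen ρ ε u ≤ ENNReal.ofReal (C * ((‖u‖ + ε) ^ 2)⁻¹) ∧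
      (1 ≤ ‖u‖ → mollGreen ρ ε u ≤ ENNReal.ofReal (C * (‖u‖ ^ 8)⁻¹)) := by
  obtain ⟨M, hM1, hM⟩ := hρ.exists_bound
  obtain ⟨R, hR1, hR⟩ := hρ.exists_radius
  refine ⟨2 * M * (2 * R + 1) ^ 8 + 4096 + 2 * (24 * 24 * 16 ^ 4), by positivity,
    fun ε hε hε1 u => ⟨?_, fun hu1 => ?_⟩⟩
  · rcases le_or_gt (2 * R * ε) ‖u‖ with hu | hu
    · refine (mollGreen_le_of_far hρ hε hR1 hR u hu).trans (ENNReal.ofReal_le_ofReal ?_)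
      have hu0 : 0 < ‖u‖ := lt_of_lt_of_le (by positivity) hu
      have h1 : (‖u‖ + ε) ≤ 2 * ‖u‖ := by nlinarith
      have h2 : (‖u‖ + ε) ^ 2 ≤ (2 * ‖u‖) ^ 2 := pow_le_pow_left₀ (by positivity) h1 2
      have h3 : 2 * 512 * (‖u‖ ^ 2)⁻¹ = 4096 * ((2 * ‖u‖) ^ 2)⁻¹ := by field_simp; norm_num
      rw [h3]
      have h4 : ((2 * ‖u‖) ^ 2)⁻¹ ≤ ((‖u‖ + ε) ^ 2)⁻¹ := inv_anti₀ (by positivity) h2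
      have h5 : (0 : ℝ) ≤ 2 * M * (2 * R + 1) ^ 8 := by positivity
      have h6 : 0 < ((2 * ‖u‖) ^ 2)⁻¹ := by positivity
      nlinarith
    · refine (mollGreen_le_eps hρ hε hM1 hM u).trans (ENNReal.ofReal_le_ofReal ?_)
      have h1 : (‖u‖ + ε) ≤ (2 * R + 1) * ε := by nlinarith
      have h2 : (‖u‖ + ε) ^ 2 ≤ ((2 * R + 1) * ε) ^ 2 := pow_le_pow_left₀ (by positivity) h1 2
      have h4 : (((2 * R + 1) * ε) ^ 2)⁻¹ ≤ ((‖u‖ + ε) ^ 2)⁻¹ := inv_anti₀ (by positivity) h2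
      have h3 : 2 * M * (ε ^ 2)⁻¹ = 2 * M * (2 * R + 1) ^ 2 * (((2 * R + 1) * ε) ^ 2)⁻¹ := by
        field_simp
      rw [h3]
      have h5 : (2 * R + 1) ^ 2 ≤ (2 * R + 1) ^ 8 := pow_le_pow_right₀ (by linarith) (by norm_num)
      have h6 : 2 * M * (2 * R + 1) ^ 2 ≤
          2 * M * (2 * R + 1) ^ 8 + 4096 + 2 * (24 * 24 * 16 ^ 4) := by nlinarith
      exact mul_le_mul h6 h4 (by positivity) (by positivity)
  · have h0 : 0 < (‖u‖ ^ 8)⁻¹ := by positivity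
    rcases le_or_gt (2 * R * ε) ‖u‖ with hu | hu
    · refine (mollGreen_le_decay hρ hε hR1 hR u hu).trans (ENNReal.ofReal_le_ofReal ?_)
      have h5 : (0 : ℝ) ≤ 2 * M * (2 * R + 1) ^ 8 := by positivity
      nlinarith
    · refine (mollGreen_le_eps hρ hε hM1 hM u).trans (ENNReal.ofReal_le_ofReal ?_)
      have h1 : ‖u‖ ≤ (2 * R + 1) * ε := by nlinarith
      have h2 : ‖u‖ ^ 2 ≤ ((2 * R + 1) * ε) ^ 2 := pow_le_pow_left₀ (by positivity) h1 2
      have h1' : ‖u‖ ≤ 2 * R + 1 := by nlinarith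
      have h2' : ‖u‖ ^ 6 ≤ (2 * R + 1) ^ 6 := pow_le_pow_left₀ (by positivity) h1' 6
      have h3 : (ε ^ 2)⁻¹ ≤ (2 * R + 1) ^ 8 * (‖u‖ ^ 8)⁻¹ := by
        rw [inv_le_comm₀ (by positivity) (by positivity), mul_inv, inv_inv,
          inv_mul_le_iff₀ (by positivity)]
        calc ‖u‖ ^ 8 = ‖u‖ ^ 2 * ‖u‖ ^ 6 := by ring
          _ ≤ ((2 * R + 1) * ε) ^ 2 * (2 * R + 1) ^ 6 :=
            mul_le_mul h2 h2' (by positivity) (by positivity)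
          _ = _ := by ring
      have h7 := mul_le_mul_of_nonneg_left h3 (by positivity : 0 ≤ 2 * M)
      nlinarith


theorem tsum_pi_prod (g : ℤ → ENNReal) (d : ℕ) :
    ∑' n : Fin d → ℤ, ∏ i, g (n i) = (∑' a, g a) ^ d := by
  induction d with
  | zero => simp
  | succ d ih =>
    rw [← (Fin.consEquiv fun _ : Fin (d + 1) => ℤ).tsum_eq]
    simp only [Fin.consEquiv, Equiv.coe_fn_mk, Fin.prod_univ_succ, Fin.cons_zero, Fin.cons_succ]
    rw [ENNReal.tsum_prod (f := fun a (n : Fin d → ℤ) => g a * ∏ i : Fin d, g (n i))]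
    simp_rw [ENNReal.tsum_mul_left]
    rw [ih, ENNReal.tsum_mul_right, pow_succ']

theorem tsum_inv_one_add_sq_lt_top :
    ∑' a : ℤ, ENNReal.ofReal ((1 + (a : ℝ) ^ 2)⁻¹) < ⊤ := by
  have hs : Summable fun a : ℤ => (1 + (a : ℝ) ^ 2)⁻¹ := by
    have h := (Real.summable_one_div_int_pow (p := 2)).2 (by norm_num)
    refine Summable.of_norm_bounded_eventually h ?_
    rw [Int.cofinite_eq]
    have : ∀ a : ℤ, a ≠ 0 → ‖(1 + (a : ℝ) ^ 2)⁻¹‖ ≤ 1 / (a : ℝ) ^ 2 := by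
      intro a ha
      have ha' : 0 < (a : ℝ) ^ 2 := by positivity
      rw [Real.norm_of_nonneg (by positivity), one_div]
      exact inv_anti₀ ha' (by linarith)
    rw [← Int.cofinite_eq]
    refine (Set.finite_singleton (0 : ℤ)).subset fun a ha => ?_
    by_contra h0
    exact ha (this a h0)
  rw [← ENNReal.ofReal_tsum_of_nonneg (fun a => by positivity) hs]
  exact ENNReal.ofReal_lt_top

theorem exists_representative (x : Torus) : ∃ ξ : EuclideanSpace ℝ (Fin 4),
    toTorus ξ = x ∧ ∀ i, |ξ i| ≤ Real.pi := by
  refine ⟨WithLp.toLp 2 fun i => (AddCircle.equivIoc (2 * Real.pi) (-Real.pi) (x i) : ℝ), ?_, ?_⟩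
  · funext i
    simp [toTorus, AddCircle.coe_equivIoc]
  · intro i
    have := (AddCircle.equivIoc (2 * Real.pi) (-Real.pi) (x i)).2
    rw [abs_le]
    exact ⟨this.1.le, by linarith [this.2]⟩

theorem norm_toTorus_le (u : EuclideanSpace ℝ (Fin 4)) : ‖toTorus u‖ ≤ ‖u‖ := by
  refine (pi_norm_le_iff_of_nonneg (norm_nonneg u)).2 fun i => ?_
  exact (QuotientAddGroup.norm_mk_le_norm (m := u i)).trans (PiLp.norm_apply_le u i)

/-- The lattice vector `2πn`. -/
noncomputable def latticeVec (n : Fin 4 → ℤ) : EuclideanSpace ℝ (Fin 4) :=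
  WithLp.toLp 2 fun i => 2 * Real.pi * n i

/-- Two representatives differ by a lattice vector, so the sum over representatives injects into a
sum over the lattice. In `ENNReal` the bound needs no summability, a divergent real sum being zero
by convention; the integrals below are treated in the same way. -/
theorem enorm_torusHeatKernel_le (t : ℝ) (u : EuclideanSpace ℝ (Fin 4)) :
    ‖torusHeatKernel t (toTorus u)‖ₑ ≤
      ∑' n : Fin 4 → ℤ, ENNReal.ofReal (heatKernel t (u + latticeVec n)) := by
  unfold torusHeatKernel
  refine enorm_tsum_le_tsum_enorm.trans ?_
  have hex : ∀ y : {y : EuclideanSpace ℝ (Fin 4) // toTorus y = toTorus u},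
      ∃ n : Fin 4 → ℤ, y.1 = u + latticeVec n := by
    rintro ⟨y, hy⟩
    have : ∀ i, ∃ n : ℤ, n • (2 * Real.pi) = y i - u i := by
      intro i
      rw [← AddCircle.coe_eq_zero_iff, AddCircle.coe_sub]
      exact sub_eq_zero.2 (congrFun hy i)
    choose n hn using this
    refine ⟨n, ?_⟩
    ext i
    have := hn i
    simp only [zsmul_eq_mul] at this
    simp only [latticeVec, PiLp.add_apply]
    linarith
  choose n hn using hex
  have hinj : Function.Injective n := fun y y' h => Subtype.ext (by rw [hn y, hn y', h])
  refine le_trans (le_of_eq ?_) (ENNReal.tsum_comp_le_tsum_of_injective hinj _)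
  refine tsum_congr fun y => ?_
  rw [← hn y, Real.enorm_eq_ofReal (heatKernel_nonneg _ _)]

theorem enorm_greenMoll_le {ρ : EuclideanSpace ℝ (Fin 4) → ℝ} (hρ : IsMollifier ρ) {ε : ℝ}
    (hε : 0 < ε) (ξ : EuclideanSpace ℝ (Fin 4)) :
    ‖greenMoll ρ ε (toTorus ξ)‖ₑ ≤ ∑' n : Fin 4 → ℤ, mollGreen ρ ε (ξ + latticeVec n) := by
  have hmρ := hρ.measurable
  have hmh := measurable_heatKernel
  have h1 : ∀ y : EuclideanSpace ℝ (Fin 4), ‖green (toTorus ξ - toTorus y)‖ₑ ≤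
      ∑' n : Fin 4 → ℤ, ∫⁻ t in Ioi (0 : ℝ), ENNReal.ofReal (Real.exp (-t)) *
        ENNReal.ofReal (heatKernel t (ξ + latticeVec n - y)) := by
    intro y
    have e : toTorus ξ - toTorus y = toTorus (ξ - y) := by
      funext i; simp [toTorus]
    rw [e, ← lintegral_tsum]
    · refine (enorm_integral_le_lintegral_enorm _).trans (lintegral_mono fun t => ?_)
      rw [enorm_mul, Real.enorm_eq_ofReal (Real.exp_nonneg _), ENNReal.tsum_mul_left]
      refine mul_le_mul_right ((enorm_torusHeatKernel_le t (ξ - y)).trans (le_of_eq ?_)) _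
      refine tsum_congr fun n => ?_
      congr 3
      abel
    · intro n
      have : Measurable fun t => heatKernel t (ξ + latticeVec n - y) :=
        hmh.comp (by fun_prop : Measurable fun t => (t, ξ + latticeVec n - y))
      fun_prop
  refine (enorm_integral_le_lintegral_enorm _).trans ?_
  calc ∫⁻ y, ‖(ε ^ 4)⁻¹ * ρ (ε⁻¹ • y) * green (toTorus ξ - toTorus y)‖ₑ
      ≤ ∫⁻ y, ∑' n : Fin 4 → ℤ, ∫⁻ t in Ioi (0 : ℝ), ENNReal.ofReal ((ε ^ 4)⁻¹ * ρ (ε⁻¹ • y)) *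
          (ENNReal.ofReal (Real.exp (-t)) *
            ENNReal.ofReal (heatKernel t (ξ + latticeVec n - y))) := by
        refine lintegral_mono fun y => ?_
        rw [enorm_mul, Real.enorm_eq_ofReal (mul_nonneg (by positivity) (hρ.nonneg _))]
        refine (mul_le_mul_right (h1 y) _).trans (le_of_eq ?_)
        rw [← ENNReal.tsum_mul_left]
        refine tsum_congr fun n => ?_
        rw [lintegral_const_mul' _ _ ENNReal.ofReal_ne_top]
    _ = ∑' n : Fin 4 → ℤ, ∫⁻ y, ∫⁻ t in Ioi (0 : ℝ),
          ENNReal.ofReal ((ε ^ 4)⁻¹ * ρ (ε⁻¹ • y)) * (ENNReal.ofReal (Real.exp (-t)) *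
            ENNReal.ofReal (heatKernel t (ξ + latticeVec n - y))) := by
        refine lintegral_tsum fun n => Measurable.aemeasurable ?_
        refine Measurable.lintegral_prod_right' (f := fun p : EuclideanSpace ℝ (Fin 4) × ℝ =>
          ENNReal.ofReal ((ε ^ 4)⁻¹ * ρ (ε⁻¹ • p.1)) * (ENNReal.ofReal (Real.exp (-p.2)) *
            ENNReal.ofReal (heatKernel p.2 (ξ + latticeVec n - p.1)))) ?_
        have : Measurable fun p : EuclideanSpace ℝ (Fin 4) × ℝ =>
            heatKernel p.2 (ξ + latticeVec n - p.1) :=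
          hmh.comp (by fun_prop : Measurable fun p : EuclideanSpace ℝ (Fin 4) × ℝ =>
            (p.2, ξ + latticeVec n - p.1))
        fun_prop
    _ = ∑' n : Fin 4 → ℤ, mollGreen ρ ε (ξ + latticeVec n) := by
        refine tsum_congr fun n => ?_
        rw [lintegral_lintegral_swap]
        · unfold mollGreen mollHeat
          refine lintegral_congr fun t => ?_
          rw [← lintegral_const_mul' _ _ ENNReal.ofReal_ne_top]
          refine lintegral_congr fun y => ?_
          ring
        · have : Measurable fun p : EuclideanSpace ℝ (Fin 4) × ℝ =>
              heatKernel p.2 (ξ + latticeVec n - p.1) :=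
            hmh.comp (by fun_prop : Measurable fun p : EuclideanSpace ℝ (Fin 4) × ℝ =>
              (p.2, ξ + latticeVec n - p.1))
          refine Measurable.aemeasurable ?_
          unfold Function.uncurry
          fun_prop

/-- For `n i ≠ 0` one has `|2π n i| - π ≥ π |n i|`, so a shifted representative is far from the
origin in proportion to the shift. -/
theorem abs_latticeVec_le {ξ : EuclideanSpace ℝ (Fin 4)} (hξ : ∀ i, |ξ i| ≤ Real.pi)
    (n : Fin 4 → ℤ) (i : Fin 4) : Real.pi * |(n i : ℝ)| ≤ ‖ξ + latticeVec n‖ := by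
  refine le_trans ?_ (PiLp.norm_apply_le (ξ + latticeVec n) i)
  simp only [PiLp.add_apply, latticeVec, Real.norm_eq_abs]
  have h1 := hξ i
  have hpi := Real.pi_pos
  by_cases h0 : n i = 0
  · simp [h0]
  · have h2 : (1 : ℝ) ≤ |(n i : ℝ)| := by
      rw [← Int.cast_abs]; exact_mod_cast Int.one_le_abs h0
    have h3 : |2 * Real.pi * (n i : ℝ)| = 2 * Real.pi * |(n i : ℝ)| := by
      rw [abs_mul, abs_of_pos Real.two_pi_pos]
    have h4 := abs_sub_abs_le_abs_sub (2 * Real.pi * (n i : ℝ)) (-(ξ i))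
    rw [abs_neg, sub_neg_eq_add, h3, add_comm _ (ξ i)] at h4
    nlinarith

/-- The unshifted term carries the singularity. The other terms sum to a constant, which is absorbed
because `‖x‖ + ε ≤ 5` makes `25 (‖x‖ + ε)⁻²` at least one. -/
theorem exists_greenMoll_le {ρ : EuclideanSpace ℝ (Fin 4) → ℝ} (hρ : IsMollifier ρ) :
    ∃ A : ℝ, 0 < A ∧ ∀ ε : ℝ, 0 < ε → ε < 1 → ∀ x : Torus,
      ‖greenMoll ρ ε x‖ₑ ≤ ENNReal.ofReal (A * ((‖x‖ + ε) ^ 2)⁻¹) := by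
  obtain ⟨C, hC, hH⟩ := exists_mollGreen_le hρ
  set T : ENNReal := (∑' a : ℤ, ENNReal.ofReal ((1 + (a : ℝ) ^ 2)⁻¹)) ^ 4 with hT
  have hTtop : T ≠ ⊤ := ENNReal.pow_ne_top tsum_inv_one_add_sq_lt_top.ne
  refine ⟨C + C * 16 * T.toReal * 25, by positivity, fun ε hε hε1 x => ?_⟩
  obtain ⟨ξ, rfl, hξ⟩ := exists_representative x
  have hnx := norm_toTorus_le ξ
  have hnx' := torus_norm_le (toTorus ξ)
  have hn0 := norm_nonneg (toTorus ξ)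
  set a := ‖toTorus ξ‖ with ha
  have hpi4 := Real.pi_le_four
  refine (enorm_greenMoll_le hρ hε ξ).trans ?_
  have hterm : ∀ n : Fin 4 → ℤ, mollGreen ρ ε (ξ + latticeVec n) ≤
      (if n = 0 then ENNReal.ofReal (C * ((a + ε) ^ 2)⁻¹) else 0) +
        ENNReal.ofReal (C * 16) * ∏ i, ENNReal.ofReal ((1 + (n i : ℝ) ^ 2)⁻¹) := by
    intro n
    by_cases hn : n = 0
    · subst hn
      rw [if_pos rfl]
      refine le_add_right ?_
      have : latticeVec 0 = 0 := by ext i; simp [latticeVec]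
      rw [this, add_zero]
      refine (hH ε hε hε1 ξ).1.trans (ENNReal.ofReal_le_ofReal ?_)
      gcongr
    · rw [if_neg hn, zero_add]
      obtain ⟨i, hi⟩ : ∃ i, n i ≠ 0 := Function.ne_iff.1 hn
      set r := ‖ξ + latticeVec n‖ with hr
      have hr1 : 1 ≤ r := by
        have h2 : (1 : ℝ) ≤ |(n i : ℝ)| := by
          rw [← Int.cast_abs]; exact_mod_cast Int.one_le_abs hi
        have := abs_latticeVec_le hξ n i
        nlinarith [Real.pi_gt_three]
      refine ((hH ε hε hε1 _).2 hr1).trans ?_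
      rw [← ENNReal.ofReal_prod_of_nonneg (fun i _ => by positivity),
        ← ENNReal.ofReal_mul (by positivity)]
      refine ENNReal.ofReal_le_ofReal ?_
      rw [Finset.prod_inv_distrib]
      have hprod : ∏ i, (1 + (n i : ℝ) ^ 2) ≤ (2 * r ^ 2) ^ 4 := by
        calc ∏ i, (1 + (n i : ℝ) ^ 2) ≤ ∏ _i : Fin 4, (2 * r ^ 2) := by
              refine Finset.prod_le_prod (fun i _ => by positivity) fun i _ => ?_
              have h5 := abs_latticeVec_le hξ n i
              have h6 : |(n i : ℝ)| ≤ r := by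
                nlinarith [Real.pi_gt_three, abs_nonneg (n i : ℝ)]
              have h7 : (n i : ℝ) ^ 2 ≤ r ^ 2 := by
                rw [← sq_abs]; exact pow_le_pow_left₀ (abs_nonneg _) h6 2
              nlinarith
          _ = _ := by simp
      have h8 : ((2 * r ^ 2) ^ 4)⁻¹ ≤ (∏ i, (1 + (n i : ℝ) ^ 2))⁻¹ :=
        inv_anti₀ (Finset.prod_pos fun i _ => by positivity) hprod
      calc C * (r ^ 8)⁻¹ = C * 16 * ((2 * r ^ 2) ^ 4)⁻¹ := by field_simp; norm_num
        _ ≤ _ := mul_le_mul_of_nonneg_left h8 (by positivity)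
  refine (ENNReal.tsum_le_tsum hterm).trans ?_
  rw [ENNReal.tsum_add, tsum_ite_eq, ENNReal.tsum_mul_left,
    tsum_pi_prod (fun b : ℤ => ENNReal.ofReal ((1 + (b : ℝ) ^ 2)⁻¹)), ← hT,
    ← ENNReal.ofReal_toReal hTtop, ← ENNReal.ofReal_mul (by positivity),
    ← ENNReal.ofReal_add (by positivity) (by positivity), ENNReal.toReal_ofReal (by positivity)]
  refine ENNReal.ofReal_le_ofReal ?_
  have h9 : 1 ≤ 25 * ((a + ε) ^ 2)⁻¹ := by
    rw [← div_eq_mul_inv, le_div_iff₀ (by positivity)]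
    nlinarith
  have h10 : 0 ≤ C * 16 * T.toReal := by positivity
  nlinarith [mul_le_mul_of_nonneg_left h9 h10]

/-! ### Merge sequences and Kruskal's algorithm. -/

/-- Merge the classes of `p.1` and `p.2` in the partition of `V` into the fibres of `f`. -/
noncomputable def mergeStep {V : Type} (f : V → V) (p : V × V) (v : V) : V :=
  open Classical in if f v = f p.2 then f p.1 else f v

/-- The fibres of `mergeMap s i` are obtained from singletons by merging the classes of the
first `i` pairs of the sequence `s`. -/
noncomputable def mergeMap {V : Type} (s : ℕ → V × V) : ℕ → V → V
  | 0 => id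
  | i + 1 => mergeStep (mergeMap s i) (s i)

/-- Each of the first `N` pairs joins two different classes. -/
def MergeIndep {V : Type} (s : ℕ → V × V) (N : ℕ) : Prop :=
  ∀ i < N, mergeMap s i (s i).1 ≠ mergeMap s i (s i).2

theorem mergeStep_eq_iff {V : Type} (f : V → V) (p : V × V) (u v : V) :
    mergeStep f p u = mergeStep f p v ↔
      f u = f v ∨ (f u = f p.1 ∧ f v = f p.2) ∨ (f u = f p.2 ∧ f v = f p.1) := by
  unfold mergeStep
  split_ifs with h1 h2 h2 <;> grind

theorem mergeMap_succ_eq_iff {V : Type} (s : ℕ → V × V) (i : ℕ) (u v : V) :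
    mergeMap s (i + 1) u = mergeMap s (i + 1) v ↔
      mergeMap s i u = mergeMap s i v ∨
      (mergeMap s i u = mergeMap s i (s i).1 ∧ mergeMap s i v = mergeMap s i (s i).2) ∨
      (mergeMap s i u = mergeMap s i (s i).2 ∧ mergeMap s i v = mergeMap s i (s i).1) :=
  mergeStep_eq_iff _ _ _ _

theorem mergeMap_eq_mono {V : Type} (s : ℕ → V × V) {i j : ℕ} (hij : i ≤ j) {u v : V}
    (h : mergeMap s i u = mergeMap s i v) : mergeMap s j u = mergeMap s j v := by
  induction hij with
  | refl => exact h
  | step _ ih => exact (mergeMap_succ_eq_iff s _ u v).2 (Or.inl ih)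

theorem mergeMap_succ_pair {V : Type} (s : ℕ → V × V) (i : ℕ) :
    mergeMap s (i + 1) (s i).1 = mergeMap s (i + 1) (s i).2 :=
  (mergeMap_succ_eq_iff s i _ _).2 (Or.inr (Or.inl ⟨rfl, rfl⟩))

theorem mergeMap_congr {V : Type} {s s' : ℕ → V × V} (i : ℕ) (h : ∀ j < i, s j = s' j) :
    mergeMap s i = mergeMap s' i := by
  induction i with
  | zero => rfl
  | succ i ih =>
    change mergeStep _ _ = mergeStep _ _
    rw [ih fun j hj => h j (by omega), h i (by omega)]

theorem range_mergeStep {V : Type} (f : V → V) (p : V × V) (h : f p.1 ≠ f p.2) :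
    range (mergeStep f p) = range f \ {f p.2} := by
  ext w
  simp only [mem_range, mem_sdiff, mem_singleton_iff, mergeStep]
  constructor
  · rintro ⟨v, rfl⟩
    split_ifs with hv
    · exact ⟨⟨_, rfl⟩, h⟩
    · exact ⟨⟨_, rfl⟩, hv⟩
  · rintro ⟨⟨v, rfl⟩, hv⟩
    exact ⟨v, if_neg hv⟩

/-- The range of `mergeMap s i` contains one label per class, and a merge of two distinct classes
deletes exactly one label. -/
theorem ncard_range_mergeMap {V : Type} [Finite V] {s : ℕ → V × V} {N : ℕ} (h : MergeIndep s N)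
    {i : ℕ} (hi : i ≤ N) : (range (mergeMap s i)).ncard + i = Nat.card V := by
  induction i with
  | zero => simp [mergeMap, range_id, ncard_univ]
  | succ i ih =>
    have h1 := ih (by omega)
    have h2 : range (mergeMap s (i + 1)) = range (mergeMap s i) \ {mergeMap s i (s i).2} :=
      range_mergeStep _ _ (h i (by omega))
    have h3 := ncard_sdiff_singleton_add_one (s := range (mergeMap s i))
      (mem_range_self (s i).2) (toFinite _)
    rw [h2]
    omega

theorem mergeMap_eq_of_card {V : Type} [Finite V] {s : ℕ → V × V} {N : ℕ} (h : MergeIndep s N)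
    (hN : Nat.card V = N + 1) (u v : V) : mergeMap s N u = mergeMap s N v := by
  have h1 := ncard_range_mergeMap h le_rfl
  have h2 : (range (mergeMap s N)).ncard = 1 := by omega
  obtain ⟨a, ha⟩ := ncard_eq_one.1 h2
  have hu : mergeMap s N u ∈ range (mergeMap s N) := mem_range_self u
  have hv : mergeMap s N v ∈ range (mergeMap s N) := mem_range_self v
  rw [ha] at hu hv
  exact hu.trans hv.symm

/-- Kruskal's algorithm: one can always merge a closest pair of points in different classes. -/
theorem exists_greedy {V : Type} [Finite V] {N : ℕ} (hN : Nat.card V = N + 1)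
    (d : V → V → ℝ) : ∃ s : ℕ → V × V, MergeIndep s N ∧ ∀ i < N, ∀ u v,
      mergeMap s i u ≠ mergeMap s i v → d (s i).1 (s i).2 ≤ d u v := by
  have hne : Nonempty V := (Nat.card_pos_iff.1 (by omega)).1
  have hpick : ∀ f : V → V, ∃ p : V × V, (∃ u v, f u ≠ f v) →
      f p.1 ≠ f p.2 ∧ ∀ u v, f u ≠ f v → d p.1 p.2 ≤ d u v := by
    intro f
    by_cases h : ∃ u v, f u ≠ f v
    · obtain ⟨u, v, huv⟩ := h
      obtain ⟨p, hp, hmin⟩ := (toFinite {p : V × V | f p.1 ≠ f p.2}).exists_minimalFor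
        (fun p => d p.1 p.2) _ ⟨(u, v), huv⟩
      refine ⟨p, fun _ => ⟨hp, fun a b hab => ?_⟩⟩
      rcases le_total (d p.1 p.2) (d a b) with hle | hle
      · exact hle
      · exact hmin (show (a, b) ∈ {p : V × V | f p.1 ≠ f p.2} from hab) hle
    · exact ⟨(hne.some, hne.some), fun h' => absurd h' h⟩
  choose pick hp using hpick
  -- The pair chosen depends only on the partition reached, so the partitions are defined by
  -- recursion and the sequence is read off from them.
  let F : ℕ → V → V := fun i => Nat.rec id (fun _ f => mergeStep f (pick f)) i
  let s : ℕ → V × V := fun i => pick (F i)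
  have hF : ∀ i, mergeMap s i = F i := by
    intro i
    induction i with
    | zero => rfl
    | succ i ih =>
      change mergeStep (mergeMap s i) (s i) = mergeStep (F i) (pick (F i))
      rw [ih]
  have hex : ∀ i, MergeIndep s i → i < N → ∃ u v, F i u ≠ F i v := by
    intro i hi hiN
    by_contra! hcon
    have h1 := ncard_range_mergeMap hi le_rfl
    rw [hF] at h1
    have h2 : (range (F i)).ncard ≤ 1 := by
      have hfin : (range (F i)).Finite := finite_range _
      refine (ncard_le_one hfin).2 ?_
      rintro _ ⟨u, rfl⟩ _ ⟨v, rfl⟩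
      exact hcon u v
    omega
  have hind : ∀ i ≤ N, MergeIndep s i := by
    intro i hi
    induction i with
    | zero => intro j hj; omega
    | succ i ih =>
      have h0 := ih (by omega)
      intro j hj
      rcases Nat.lt_succ_iff_lt_or_eq.1 hj with hj | rfl
      · exact h0 j hj
      · rw [hF]; exact (hp (F j) (hex j h0 (by omega))).1
  refine ⟨s, hind N le_rfl, fun i hi u v huv => ?_⟩
  rw [hF] at huv
  exact (hp (F i) ⟨u, v, huv⟩).2 u v huv

/-- Differences along a forest can be prescribed freely: to adjust the last one, translate the whole
class of `(s N).1`. Earlier pairs lie inside one class each, so their differences do not change. -/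
theorem exists_sub_eq {V : Type} {T : Type} [AddCommGroup T] {s : ℕ → V × V} (N : ℕ)
    (h : MergeIndep s N) (z : ℕ → T) : ∃ x : V → T, ∀ i < N, x (s i).1 - x (s i).2 = z i := by
  classical
  induction N with
  | zero => exact ⟨fun _ => 0, fun i hi => absurd hi (by omega)⟩
  | succ N ih =>
    obtain ⟨x, hx⟩ := ih fun i hi => h i (by omega)
    refine ⟨fun v => if mergeMap s N v = mergeMap s N (s N).1 then
      x v + (z N - (x (s N).1 - x (s N).2)) else x v, fun i hi => ?_⟩
    rcases Nat.lt_succ_iff_lt_or_eq.1 hi with hi | rfl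
    · have h1 : mergeMap s N (s i).1 = mergeMap s N (s i).2 :=
        mergeMap_eq_mono s (by omega) (mergeMap_succ_pair s i)
      simp only [h1]
      split_ifs
      · rw [add_sub_add_right_eq_sub, hx i hi]
      · exact hx i hi
    · simp only [if_true, if_neg (h i (by omega)).symm]
      abel

/-- The number of edges joining vertices merged in the first `i` steps. -/
noncomputable def mergedCount {V E : Type} (p q : E → V) (s : ℕ → V × V) (i : ℕ) : ℕ :=
  {e | mergeMap s i (p e) = mergeMap s i (q e)}.ncard

/-- The number of edges absorbed in step `i`. -/
noncomputable def stepCount {V E : Type} (p q : E → V) (s : ℕ → V × V) (i : ℕ) : ℕ :=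
  {e | mergeMap s i (p e) ≠ mergeMap s i (q e) ∧
    mergeMap s (i + 1) (p e) = mergeMap s (i + 1) (q e)}.ncard

theorem mergedCount_succ {V E : Type} [Finite E] (p q : E → V) (s : ℕ → V × V) (i : ℕ) :
    mergedCount p q s (i + 1) = mergedCount p q s i + stepCount p q s i := by
  unfold mergedCount stepCount
  rw [← ncard_union_eq _ (toFinite _) (toFinite _)]
  · congr 1
    ext e
    simp only [mem_ofPred_eq, mem_union]
    constructor
    · intro h
      by_cases h' : mergeMap s i (p e) = mergeMap s i (q e)
      · exact Or.inl h'
      · exact Or.inr ⟨h', h⟩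
    · rintro (h | h)
      · exact mergeMap_eq_mono s (Nat.le_succ i) h
      · exact h.2
  · rw [Set.disjoint_left]
    rintro e he ⟨h1, _⟩
    exact h1 he

/-! ### Spanning tree coordinates and the integral of a graph. -/

theorem volume_torus_ne_zero : volume (univ : Set Torus) ≠ 0 :=
  (isOpen_univ.measure_pos volume univ_nonempty).ne'

theorem volume_torus_ne_top : volume (univ : Set Torus) ≠ ⊤ := measure_ne_top _ _

theorem volume_pi_torus_univ (ι : Type) [Fintype ι] :
    volume (univ : Set (ι → Torus)) = volume (univ : Set Torus) ^ Fintype.card ι := by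
  rw [volume_pi, Measure.pi_univ, Finset.prod_const, Finset.card_univ]

instance isAddHaarMeasure_torus_family (ι : Type) [Fintype ι] :
    (volume : Measure (ι → Torus)).IsAddHaarMeasure :=
  haveI : (volume : Measure Torus).IsAddHaarMeasure := inferInstance
  inferInstanceAs (Measure.pi _).IsAddHaarMeasure

/-- The change of variables from the points to the differences along a spanning tree. -/
theorem lintegral_comp_differences {V : Type} [Fintype V] {N : ℕ} (hN : Nat.card V = N + 1)
    {s : ℕ → V × V} (hs : MergeIndep s N) (F : (Fin N → Torus) → ENNReal) (hF : Measurable F) :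
    ∫⁻ x : V → Torus, F (fun i => x (s i).1 - x (s i).2) =
      volume (univ : Set Torus) * ∫⁻ z, F z := by
  let D : (V → Torus) →+ (Fin N → Torus) :=
    { toFun := fun x i => x (s i).1 - x (s i).2
      map_zero' := by funext i; simp
      map_add' := fun x y => by funext i; simp only [Pi.add_apply]; abel }
  have hc : Continuous D := by
    refine continuous_pi fun i => ?_
    change Continuous fun x : V → Torus => x (s i).1 - x (s i).2
    fun_prop
  have hsurj : Function.Surjective D := by
    intro z
    obtain ⟨x, hx⟩ := exists_sub_eq N hs (fun i => if h : i < N then z ⟨i, h⟩ else 0)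
    refine ⟨x, funext fun i => ?_⟩
    change x (s i).1 - x (s i).2 = z i
    have := hx i i.2
    simpa using this
  have hH : ((volume (univ : Set Torus)) • (volume : Measure (Fin N → Torus))).IsAddHaarMeasure :=
    Measure.IsAddHaarMeasure.smul _ volume_torus_ne_zero volume_torus_ne_top
  have hm : MeasurePreserving D volume
      ((volume (univ : Set Torus)) • (volume : Measure (Fin N → Torus))) := by
    -- A continuous surjective homomorphism of compact groups carries Haar measure to Haar measure;
    -- the total masses fix the normalisation.
    refine AddMonoidHom.measurePreserving hc hsurj ?_
    rw [Measure.smul_apply, volume_pi_torus_univ, volume_pi_torus_univ, smul_eq_mul,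
      ← Nat.card_eq_fintype_card, hN, Fintype.card_fin, pow_succ']
  have := hm.lintegral_comp hF
  rw [lintegral_smul_measure, smul_eq_mul] at this
  exact this

/-- Just before the step that absorbs an edge, its endpoints lie in different classes, so by
greediness the edge is no shorter than the pair merged in that step. Replacing each edge by this
pair only increases the product. -/
theorem prod_edges_le {V E : Type} [Finite V] [Fintype E] {N : ℕ} (hN : Nat.card V = N + 1)
    (p q : E → V) (hloop : ∀ e, p e ≠ q e) {ε : ℝ} (hε : 0 < ε) (x : V → Torus)
    {s : ℕ → V × V} (hs : MergeIndep s N) (hgreedy : ∀ i < N, ∀ u v,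
      mergeMap s i u ≠ mergeMap s i v → ‖x (s i).1 - x (s i).2‖ ≤ ‖x u - x v‖) :
    ∏ e, ENNReal.ofReal (((‖x (p e) - x (q e)‖ + ε) ^ 2)⁻¹) ≤
      (orderedSet N 4).indicator
        (fun z => ∏ i, ENNReal.ofReal ((‖z i‖ + ε) ^ (-(2 * stepCount p q s i : ℕ) : ℤ)))
        (fun i => x (s i).1 - x (s i).2) := by
  classical
  rw [indicator_of_mem]
  swap
  · refine ⟨fun i j hij => ?_, fun i => (torus_norm_le _).trans Real.pi_le_four⟩
    -- The lengths increase because the pair merged later, at `j`, was already a competitor at step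
    -- `i`.
    exact hgreedy i i.2 _ _ fun h => hs j j.2 (mergeMap_eq_mono s hij h)
  have hstage : ∀ e, ∃ i : Fin N, mergeMap s i (p e) ≠ mergeMap s i (q e) ∧
      mergeMap s (i + 1) (p e) = mergeMap s (i + 1) (q e) := by
    intro e
    have hex : ∃ i, mergeMap s i (p e) = mergeMap s i (q e) :=
      ⟨N, mergeMap_eq_of_card hs hN _ _⟩
    have hfind := Nat.find_spec hex
    have hle : Nat.find hex ≤ N := Nat.find_min' hex (mergeMap_eq_of_card hs hN _ _)
    obtain ⟨i, hi⟩ : ∃ i, Nat.find hex = i + 1 := by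
      refine Nat.exists_eq_succ_of_ne_zero fun h0 => ?_
      rw [h0] at hfind
      exact hloop e hfind
    refine ⟨⟨i, by omega⟩, Nat.find_min hex (by simp [hi]), ?_⟩
    rw [hi] at hfind
    exact hfind
  choose τ hτ1 hτ2 using hstage
  have hcard : ∀ i : Fin N, (Finset.univ.filter fun e => τ e = i).card = stepCount p q s i := by
    intro i
    unfold stepCount
    rw [← Set.ncard_coe_finset]
    congr 1
    ext e
    simp only [Finset.coe_filter, Finset.mem_univ, true_and, mem_ofPred_eq]
    constructor
    · rintro rfl; exact ⟨hτ1 e, hτ2 e⟩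
    · rintro ⟨h1, h2⟩
      refine Fin.ext (le_antisymm ?_ ?_)
      · by_contra! hlt
        exact hτ1 e (mergeMap_eq_mono s (by omega) h2)
      · by_contra! hlt
        exact h1 (mergeMap_eq_mono s (by omega) (hτ2 e))
  calc ∏ e, ENNReal.ofReal (((‖x (p e) - x (q e)‖ + ε) ^ 2)⁻¹)
      ≤ ∏ e, ENNReal.ofReal (((‖x (s (τ e)).1 - x (s (τ e)).2‖ + ε) ^ 2)⁻¹) := by
        refine Finset.prod_le_prod' fun e _ => ENNReal.ofReal_le_ofReal ?_
        have := hgreedy (τ e) (τ e).2 _ _ (hτ1 e)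
        gcongr
    _ = ∏ i : Fin N, ∏ e with τ e = i,
          ENNReal.ofReal (((‖x (s i).1 - x (s i).2‖ + ε) ^ 2)⁻¹) :=
        (Finset.prod_fiberwise' Finset.univ τ fun i : Fin N =>
          ENNReal.ofReal (((‖x (s i).1 - x (s i).2‖ + ε) ^ 2)⁻¹)).symm
    _ = _ := by
        refine Finset.prod_congr rfl fun i _ => ?_
        rw [Finset.prod_const, hcard, ← ENNReal.ofReal_pow (by positivity), zpow_neg,
          zpow_natCast, pow_mul, inv_pow]

/-- Extend a finite sequence by a constant. -/
def extendSeq {V : Type} (v : V) {N : ℕ} (s : Fin N → V × V) (i : ℕ) : V × V :=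
  if h : i < N then s ⟨i, h⟩ else (v, v)

/-- The greedy sequence depends on the configuration `x`, so it is summed out: at each `x` one of
the at most `((N + 1) ^ 2) ^ N` sequences dominates the integrand, and each is integrated over the
whole space. -/
theorem lintegral_graph_le {V E : Type} [Fintype V] [Fintype E] {N : ℕ}
    (hN : Nat.card V = N + 1) (p q : E → V) (Z : ℕ)
    (hdeg : ∀ s, MergeIndep s N → ∀ i ≤ N, mergedCount p q s i ≤ 2 * i)
    (hZ : ∀ s, MergeIndep s N → numZeros (fun i => 4 * i - 2 * mergedCount p q s i) N ≤ Z)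
    {ε : ℝ} (hε : 0 < ε) (hε1 : ε < 1) :
    ∫⁻ x : V → Torus, ∏ e, ENNReal.ofReal (((‖x (p e) - x (q e)‖ + ε) ^ 2)⁻¹) ≤
      ENNReal.ofReal (((N + 1) ^ 2) ^ N * (volume (univ : Set Torus)).toReal *
        (400 ^ N * 5 ^ (4 * N)) * logFactor ε ^ Z) := by
  classical
  have hne : Nonempty V := (Nat.card_pos_iff.1 (by omega)).1
  obtain ⟨v⟩ := hne
  have hlf := one_le_logFactor hε hε1
  set W : (V → Torus) → ENNReal :=
    fun x => ∏ e, ENNReal.ofReal (((‖x (p e) - x (q e)‖ + ε) ^ 2)⁻¹) with hW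
  set F : (Fin N → V × V) → (Fin N → Torus) → ENNReal := fun s =>
    (orderedSet N 4).indicator fun z =>
      ∏ i, ENNReal.ofReal ((‖z i‖ + ε) ^ (-(2 * stepCount p q (extendSeq v s) i : ℕ) : ℤ)) with hF
  have hFm : ∀ s, Measurable (F s) := by
    intro s
    refine Measurable.indicator ?_ (measurableSet_orderedSet N 4)
    refine Finset.measurable_prod _ fun i _ => ?_
    fun_prop
  set S : Finset (Fin N → V × V) := Finset.univ.filter fun s => MergeIndep (extendSeq v s) N
  set D : (Fin N → V × V) → (V → Torus) → Fin N → Torus := fun s x i => x (s i).1 - x (s i).2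
  have hext : ∀ (s : Fin N → V × V) (i : Fin N), extendSeq v s i = s i := by
    intro s i; simp [extendSeq]
  -- The degree condition at `i = 0` says that no edge is merged from the start, which excludes
  -- loops.
  have hloop : (∃ s : ℕ → V × V, MergeIndep s N) → ∀ e, p e ≠ q e := by
    rintro ⟨s, hs⟩ e he
    have h0 := hdeg s hs 0 (Nat.zero_le _)
    have : {e | mergeMap s 0 (p e) = mergeMap s 0 (q e)} = ∅ :=
      (ncard_eq_zero (toFinite _)).1 (Nat.le_zero.1 h0)
    exact (this ▸ (show e ∈ {e | mergeMap s 0 (p e) = mergeMap s 0 (q e)} from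
      congrArg _ he) : e ∈ (∅ : Set E))
  have hpt : ∀ x, W x ≤ ∑ s ∈ S, F s (D s x) := by
    intro x
    obtain ⟨s, hs, hg⟩ := exists_greedy hN fun u v => ‖x u - x v‖
    set s' : Fin N → V × V := fun i => s i
    have hagree : ∀ i < N, extendSeq v s' i = s i := fun i hi => by simp [extendSeq, hi, s']
    have hmm : ∀ i ≤ N, mergeMap (extendSeq v s') i = mergeMap s i := fun i hi =>
      mergeMap_congr i fun j hj => hagree j (by omega)
    have hind : MergeIndep (extendSeq v s') N := by
      intro i hi
      rw [hmm i hi.le, hagree i hi]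
      exact hs i hi
    have hle := prod_edges_le hN p q (hloop ⟨s, hs⟩) hε x hind (by
      intro i hi
      rw [hmm i hi.le, hagree i hi]
      exact hg i hi)
    simp only [hext] at hle
    refine hle.trans ?_
    exact Finset.single_le_sum (f := fun s => F s (D s x)) (fun _ _ => zero_le)
      (Finset.mem_filter.2 ⟨Finset.mem_univ s', hind⟩)
  refine (lintegral_mono hpt).trans ?_
  have hDm : ∀ s, Measurable (D s) := by
    intro s
    refine measurable_pi_lambda _ fun i => ?_
    change Measurable fun x : V → Torus => x (s i).1 - x (s i).2
    fun_prop
  have hFDm : ∀ s, Measurable fun x => F s (D s x) := fun s => (hFm s).comp (hDm s)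
  rw [lintegral_finsetSum _ fun s _ => hFDm s]
  have hterm : ∀ s ∈ S, ∫⁻ x, F s (D s x) ≤
      ENNReal.ofReal ((volume (univ : Set Torus)).toReal *
        (400 ^ N * 5 ^ (4 * N)) * logFactor ε ^ Z) := by
    intro s hs
    have hind := (Finset.mem_filter.1 hs).2
    have h1 := lintegral_comp_differences hN hind (F s) (hFm s)
    simp only [hext] at h1
    change ∫⁻ x, F s (D s x) = _ at h1
    rw [h1]
    -- The natural subtraction in the degree is an honest one up to `N` by `hdeg`.
    have h2 := lintegral_orderedSet_le ε hε hε1 (stepCount p q (extendSeq v s))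
      (fun i => 4 * i - 2 * mergedCount p q (extendSeq v s) i) (by simp) N (by
        intro i hi
        have a1 := hdeg _ hind i hi.le
        have a2 := hdeg _ hind (i + 1) hi
        have a3 := mergedCount_succ p q (extendSeq v s) i
        omega) 4 (by norm_num) le_rfl
    refine (mul_le_mul_right h2 _).trans ?_
    rw [← ENNReal.ofReal_toReal volume_torus_ne_top, ← ENNReal.ofReal_mul ENNReal.toReal_nonneg,
      ENNReal.toReal_ofReal ENNReal.toReal_nonneg, mul_assoc _ _ (logFactor ε ^ Z)]
    refine ENNReal.ofReal_le_ofReal (mul_le_mul_of_nonneg_left ?_ ENNReal.toReal_nonneg)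
    have h3 : (4 + ε) ^ (4 * N - 2 * mergedCount p q (extendSeq v s) N) ≤ (5 : ℝ) ^ (4 * N) :=
      (pow_le_pow_left₀ (by linarith) (by linarith : 4 + ε ≤ 5) _).trans
        (pow_le_pow_right₀ (by norm_num) (Nat.sub_le _ _))
    have h4 : logFactor ε ^ numZeros (fun i => 4 * i - 2 * mergedCount p q (extendSeq v s) i) N ≤
        logFactor ε ^ Z := pow_le_pow_right₀ hlf (hZ _ hind)
    have h5 : 0 ≤ logFactor ε := by linarith
    gcongr
  refine (Finset.sum_le_card_nsmul S _ _ hterm).trans ?_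
  rw [nsmul_eq_mul, ← ENNReal.ofReal_natCast, ← ENNReal.ofReal_mul (by positivity)]
  refine ENNReal.ofReal_le_ofReal ?_
  have hcardS : (S.card : ℝ) ≤ (((N : ℝ) + 1) ^ 2) ^ N := by
    have h1 : S.card ≤ ((N + 1) ^ 2) ^ N := by
      refine (Finset.card_le_univ S).trans_eq ?_
      rw [Fintype.card_fun, Fintype.card_prod, ← Nat.card_eq_fintype_card, hN, Fintype.card_fin,
        pow_two]
    calc (S.card : ℝ) ≤ (((N + 1) ^ 2) ^ N : ℕ) := by exact_mod_cast h1
      _ = _ := by push_cast; rfl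
  have h5 : 0 ≤ logFactor ε := by linarith
  calc _ ≤ (((N : ℝ) + 1) ^ 2) ^ N * ((volume (univ : Set Torus)).toReal *
        (400 ^ N * 5 ^ (4 * N)) * logFactor ε ^ Z) := by gcongr
    _ = _ := by ring

/-! ### Degrees of subdiagrams and merge counts. -/

namespace FeynmanDiagram

/-- The internal edges whose endpoints have the same image under `f`. -/
def fibreEdges (Γ : FeynmanDiagram) {α : Type} (f : Γ.I → α) : Set Γ.E :=
  {e | ∃ u v, Γ.src e = Sum.inl u ∧ Γ.tgt e = Sum.inl v ∧ f u = f v}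

/-- The source of an internal edge. -/
noncomputable def intSrc (Γ : FeynmanDiagram) (e : Γ.intEdges) : Γ.I := e.2.1.choose

/-- The target of an internal edge. -/
noncomputable def intTgt (Γ : FeynmanDiagram) (e : Γ.intEdges) : Γ.I := e.2.2.choose

theorem src_eq_intSrc (Γ : FeynmanDiagram) (e : Γ.intEdges) : Γ.src e = Sum.inl (Γ.intSrc e) :=
  e.2.1.choose_spec

theorem tgt_eq_intTgt (Γ : FeynmanDiagram) (e : Γ.intEdges) : Γ.tgt e = Sum.inl (Γ.intTgt e) :=
  e.2.2.choose_spec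

theorem mergedCount_eq_ncard (Γ : FeynmanDiagram) (s : ℕ → Γ.I × Γ.I) (i : ℕ) :
    mergedCount Γ.intSrc Γ.intTgt s i = (Γ.fibreEdges (mergeMap s i)).ncard := by
  unfold mergedCount
  rw [← ncard_image_of_injective _ Subtype.val_injective]
  congr 1
  ext e
  simp only [mem_image, mem_ofPred_eq, fibreEdges]
  constructor
  · rintro ⟨e, h, rfl⟩
    exact ⟨_, _, Γ.src_eq_intSrc e, Γ.tgt_eq_intTgt e, h⟩
  · rintro ⟨u, v, hu, hv, h⟩
    refine ⟨⟨e, ⟨u, hu⟩, ⟨v, hv⟩⟩, ?_, rfl⟩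
    have h1 := Γ.src_eq_intSrc ⟨e, ⟨u, hu⟩, ⟨v, hv⟩⟩
    have h2 := Γ.tgt_eq_intTgt ⟨e, ⟨u, hu⟩, ⟨v, hv⟩⟩
    rw [← Sum.inl.inj (hu.symm.trans h1), ← Sum.inl.inj (hv.symm.trans h2)]
    exact h

/-- A function on the vertices that is constant along the edges is constant on components. -/
theorem eq_of_reachable (Γ : FeynmanDiagram) {α : Type*} (c : Γ.I ⊕ Γ.L → α)
    (hc : ∀ e, c (Γ.src e) = c (Γ.tgt e)) {a b : Γ.I ⊕ Γ.L} (h : Γ.graph.Reachable a b) :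
    c a = c b := by
  obtain ⟨w⟩ := h
  induction w with
  | nil => rfl
  | cons hadj _ ih =>
    refine Eq.trans ?_ ih
    rcases ((SimpleGraph.fromRel_adj _ _ _).1 hadj).2 with ⟨e, rfl, rfl⟩ | ⟨e, rfl, rfl⟩
    · exact hc e
    · exact (hc e).symm

theorem reachable_of_edge (Γ : FeynmanDiagram) (e : Γ.E) :
    Γ.graph.Reachable (Γ.src e) (Γ.tgt e) := by
  by_cases h : Γ.src e = Γ.tgt e
  · rw [h]
  · exact SimpleGraph.Adj.reachable ((SimpleGraph.fromRel_adj _ _ _).2 ⟨h, Or.inl ⟨e, rfl, rfl⟩⟩)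

instance finite_connectedComponent (Γ : FeynmanDiagram) : Finite Γ.graph.ConnectedComponent :=
  Quot.finite _

/-- The subdiagram of all vertices and of the edges inside the fibres of `f`. -/
def fibreSubdiagram (Γ : FeynmanDiagram) {α : Type} (f : Γ.I → α) : Γ.Subdiagram where
  verts := univ
  edges := Γ.fibreEdges f
  src_mem := fun _ ⟨u, _, hu, _, _⟩ => ⟨u, mem_univ u, hu⟩
  tgt_mem := fun _ ⟨_, v, _, hv, _⟩ => ⟨v, mem_univ v, hv⟩

theorem toDiagram_src_eq {Γ : FeynmanDiagram} (γ : Γ.Subdiagram) (e : γ.toDiagram.E) :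
    ∃ v : {v : Γ.I // v ∈ γ.verts}, γ.toDiagram.src e = Sum.inl v ∧ Γ.src e.1 = Sum.inl v.1 :=
  ⟨⟨_, (γ.src_mem e.1 e.2).choose_spec.1⟩, rfl, (γ.src_mem e.1 e.2).choose_spec.2⟩

theorem toDiagram_tgt_eq {Γ : FeynmanDiagram} (γ : Γ.Subdiagram) (e : γ.toDiagram.E) :
    ∃ v : {v : Γ.I // v ∈ γ.verts}, γ.toDiagram.tgt e = Sum.inl v ∧ Γ.tgt e.1 = Sum.inl v.1 :=
  ⟨⟨_, (γ.tgt_mem e.1 e.2).choose_spec.1⟩, rfl, (γ.tgt_mem e.1 e.2).choose_spec.2⟩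

/-- As `f` is constant along the edges kept, the components surject onto its values. The inequality
may be strict, since a fibre need not be connected. -/
theorem ncard_range_le_card_components (Γ : FeynmanDiagram) {α : Type} (f : Γ.I → α) :
    (range f).ncard ≤
      Nat.card (Γ.fibreSubdiagram f).toDiagram.graph.ConnectedComponent := by
  set Δ := (Γ.fibreSubdiagram f).toDiagram
  let c : Δ.I ⊕ Δ.L → range f := fun w =>
    match w with
    | Sum.inl v => ⟨f v.1, mem_range_self _⟩
    | Sum.inr l => nomatch l
  have hc : ∀ e, c (Δ.src e) = c (Δ.tgt e) := by
    intro e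
    obtain ⟨u, hu, hu'⟩ := toDiagram_src_eq _ e
    obtain ⟨v, hv, hv'⟩ := toDiagram_tgt_eq _ e
    rw [hu, hv]
    obtain ⟨u', v', h1, h2, h3⟩ := e.2
    have e1 := Sum.inl.inj (hu'.symm.trans h1)
    have e2 := Sum.inl.inj (hv'.symm.trans h2)
    refine Subtype.ext ?_
    change f u.1 = f v.1
    rw [e1, e2, h3]
  let g : Δ.graph.ConnectedComponent → range f := Quot.lift c fun _ _ h => eq_of_reachable Δ c hc h
  have hg : Function.Surjective g := by
    rintro ⟨_, v, rfl⟩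
    exact ⟨Δ.graph.connectedComponentMk (Sum.inl ⟨v, mem_univ v⟩), rfl⟩
  rw [← Nat.card_coe_set_eq]
  exact Nat.card_le_card_of_surjective g hg

/-- This links analysis and combinatorics. After `i` merges there are `|V⋆| - i` classes, hence at
least as many components, so the exponent of the nested integral dominates the degree of a genuine
subdiagram. -/
theorem degree_fibreSubdiagram_le (Γ : FeynmanDiagram) {N : ℕ} {s : ℕ → Γ.I × Γ.I}
    (hs : MergeIndep s N) {i : ℕ} (hi : i ≤ N) :
    (Γ.fibreSubdiagram (mergeMap s i)).degree ≤
      4 * (i : ℤ) - 2 * (mergedCount Γ.intSrc Γ.intTgt s i : ℤ) := by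
  have h1 := ncard_range_mergeMap hs hi
  have h2 := Γ.ncard_range_le_card_components (mergeMap s i)
  have h3 : (Γ.fibreSubdiagram (mergeMap s i)).verts.ncard = Nat.card Γ.I := ncard_univ _
  unfold Subdiagram.degree
  rw [h3, mergedCount_eq_ncard]
  change _ - 2 * ((Γ.fibreEdges (mergeMap s i)).ncard : ℤ) ≤ _
  omega

theorem degree_nonneg_of_edges_eq_empty {Γ : FeynmanDiagram} (γ : Γ.Subdiagram)
    (h : γ.edges = ∅) : 0 ≤ γ.degree := by
  unfold Subdiagram.degree
  have h1 : Nat.card γ.toDiagram.graph.ConnectedComponent ≤ γ.verts.ncard := by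
    rw [← Nat.card_coe_set_eq]
    refine Nat.card_le_card_of_surjective
      (fun v : γ.verts => γ.toDiagram.graph.connectedComponentMk (Sum.inl v)) ?_
    rintro ⟨v | l⟩
    · exact ⟨v, rfl⟩
    · exact nomatch l
  rw [h, ncard_empty]
  push_cast
  omega

theorem IsPositive.degree_nonneg {Γ : FeynmanDiagram} (h : Γ.IsPositive) (γ : Γ.Subdiagram) :
    0 ≤ γ.degree := by
  rcases γ.edges.eq_empty_or_nonempty with h0 | h0
  · exact degree_nonneg_of_edges_eq_empty γ h0
  · exact (h γ h0).le

theorem mergedCount_le_of_degree_nonneg {Γ : FeynmanDiagram} (h : ∀ γ : Γ.Subdiagram, 0 ≤ γ.degree)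
    {N : ℕ} {s : ℕ → Γ.I × Γ.I} (hs : MergeIndep s N) {i : ℕ} (hi : i ≤ N) :
    mergedCount Γ.intSrc Γ.intTgt s i ≤ 2 * i := by
  have := (h _).trans (Γ.degree_fibreSubdiagram_le hs hi)
  omega

theorem IsPositive.mergedCount_lt {Γ : FeynmanDiagram} (h : Γ.IsPositive)
    {N : ℕ} {s : ℕ → Γ.I × Γ.I} (hs : MergeIndep s N) {i : ℕ} (hi : i < N) :
    mergedCount Γ.intSrc Γ.intTgt s (i + 1) < 2 * (i + 1) := by
  rcases (Γ.fibreEdges (mergeMap s (i + 1))).eq_empty_or_nonempty with h0 | h0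
  · rw [mergedCount_eq_ncard, h0, ncard_empty]
    omega
  · have := (h (Γ.fibreSubdiagram (mergeMap s (i + 1))) h0).trans_le
      (Γ.degree_fibreSubdiagram_le hs (by omega))
    push_cast at this
    omega

/-! ### Legs, and the recognition of nested bubbles. -/

/-- Every edge is internal or a leg, and every leaf carries exactly one leg. -/
structure HasLegs (Γ : FeynmanDiagram) : Prop where
  edge : ∀ e, e ∈ Γ.intEdges ∨ (∃ l v, Γ.src e = Sum.inr l ∧ Γ.tgt e = Sum.inl v) ∨
    ∃ v l, Γ.src e = Sum.inl v ∧ Γ.tgt e = Sum.inr l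
  leaf : ∀ l, ∃! e, Γ.src e = Sum.inr l ∨ Γ.tgt e = Sum.inr l

/-- Contracting the first pair and then performing the remaining merges yields the original
partition, with the index shifted by one. -/
theorem quot_mk_eq_iff_mergeMap {V : Type} (s : ℕ → V × V) {r : V → V → Prop}
    (hr : ∀ u v, r u v ↔ (u = (s 0).1 ∨ u = (s 0).2) ∧ (v = (s 0).1 ∨ v = (s 0).2)) (i : ℕ)
    (u v : V) :
    mergeMap (fun j => (Quot.mk r (s (j + 1)).1, Quot.mk r (s (j + 1)).2)) i (Quot.mk r u) =
      mergeMap (fun j => (Quot.mk r (s (j + 1)).1, Quot.mk r (s (j + 1)).2)) i (Quot.mk r v) ↔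
    mergeMap s (i + 1) u = mergeMap s (i + 1) v := by
  induction i generalizing u v with
  | zero =>
    change Quot.mk r u = Quot.mk r v ↔ _
    constructor
    · intro h
      have hl : ∀ a b, r a b → mergeMap s 1 a = mergeMap s 1 b := by
        intro a b hab
        have hp := mergeMap_succ_pair s 0
        rcases (hr a b).1 hab with ⟨rfl | rfl, rfl | rfl⟩ <;> simp_all
      exact congrArg (Quot.lift (mergeMap s 1) hl) h
    · intro h
      rw [mergeMap_succ_eq_iff] at h
      rcases h with h | ⟨h1, h2⟩ | ⟨h1, h2⟩
      · exact congrArg _ h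
      · exact Quot.sound ((hr u v).2 ⟨Or.inl h1, Or.inr h2⟩)
      · exact Quot.sound ((hr u v).2 ⟨Or.inr h1, Or.inl h2⟩)
  | succ i ih =>
    rw [mergeMap_succ_eq_iff, mergeMap_succ_eq_iff s (i + 1)]
    simp only [ih]

theorem HasLegs.contract {Γ : FeynmanDiagram} (h : Γ.HasLegs) (S : Set Γ.Subdiagram) :
    (Γ.contract S).HasLegs where
  edge := by
    rintro ⟨e, he⟩
    rcases h.edge e with ⟨⟨u, hu⟩, v, hv⟩ | ⟨l, v, hl, hv⟩ | ⟨v, l, hv, hl⟩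
    · exact Or.inl ⟨⟨_, congrArg (Sum.map (Quot.mk _) id) hu⟩,
        ⟨_, congrArg (Sum.map (Quot.mk _) id) hv⟩⟩
    · exact Or.inr (Or.inl ⟨l, _, congrArg (Sum.map (Quot.mk _) id) hl,
        congrArg (Sum.map (Quot.mk _) id) hv⟩)
    · exact Or.inr (Or.inr ⟨_, l, congrArg (Sum.map (Quot.mk _) id) hv,
        congrArg (Sum.map (Quot.mk _) id) hl⟩)
  leaf := by
    intro l
    obtain ⟨e, he, huniq⟩ := h.leaf l
    have hnot : ∀ γ ∈ S, e ∉ γ.edges := by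
      intro γ _ hmem
      obtain ⟨u, _, hu⟩ := γ.src_mem e hmem
      obtain ⟨v, _, hv⟩ := γ.tgt_mem e hmem
      simp [hu, hv] at he
    have hback : ∀ w : Γ.I ⊕ Γ.L, ∀ r : Γ.I → Γ.I → Prop,
        Sum.map (Quot.mk r) id w = Sum.inr l → w = Sum.inr l := by
      rintro (v | l') r hw
      · simp at hw
      · exact congrArg _ (Sum.inr.inj hw)
    refine ⟨⟨e, hnot⟩, ?_, ?_⟩
    · refine he.imp (fun h => ?_) fun h => ?_
      · exact congrArg (Sum.map (Quot.mk _) id) h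
      · exact congrArg (Sum.map (Quot.mk _) id) h
    · rintro ⟨e', he'⟩ hl
      exact Subtype.ext (huniq e' (hl.imp (hback _ _) (hback _ _)))

/-- The counts at 0 and 1 say that there are no loops and that exactly two edges join the first
pair, which is thus a full bubble. After its contraction the shifted sequence satisfies the same
hypotheses, each count having dropped by two. -/
theorem isNestedBubble_of_mergedCount (N : ℕ) (Γ : FeynmanDiagram) (hlegs : Γ.HasLegs)
    (hL : Nat.card Γ.L = 4) (hI : Nat.card Γ.I = N + 1) (s : ℕ → Γ.I × Γ.I)
    (hs : MergeIndep s N) (hcount : ∀ i ≤ N, (Γ.fibreEdges (mergeMap s i)).ncard = 2 * i) :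
    IsNestedBubble Γ := by
  induction N generalizing Γ with
  | zero =>
    refine IsNestedBubble.cross Γ ?_
    have h0 : Γ.fibreEdges (mergeMap s 0) = ∅ := (ncard_eq_zero (toFinite _)).1 (hcount 0 le_rfl)
    have hint : Γ.intEdges = ∅ := by
      rw [eq_empty_iff_forall_notMem]
      rintro e ⟨⟨u, hu⟩, v, hv⟩
      have hsub : Subsingleton Γ.I := (Nat.card_eq_one_iff_unique.1 hI).1
      exact eq_empty_iff_forall_notMem.1 h0 e ⟨u, v, hu, hv, congrArg _ (Subsingleton.elim u v)⟩
    refine ⟨hI, hL, hint, fun e => ?_, hlegs.leaf⟩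
    rcases hlegs.edge e with h | h
    · rw [hint] at h; exact h.elim
    · exact h
  | succ N ih =>
    have hne : (s 0).1 ≠ (s 0).2 := hs 0 (by omega)
    have h0 : Γ.fibreEdges (mergeMap s 0) = ∅ :=
      (ncard_eq_zero (toFinite _)).1 (hcount 0 (Nat.zero_le _))
    have hends : ∀ e ∈ Γ.fibreEdges (mergeMap s 1),
        (Γ.src e = Sum.inl (s 0).1 ∧ Γ.tgt e = Sum.inl (s 0).2) ∨
        (Γ.src e = Sum.inl (s 0).2 ∧ Γ.tgt e = Sum.inl (s 0).1) := by
      rintro e ⟨u, v, hu, hv, huv⟩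
      rcases (mergeMap_succ_eq_iff s 0 u v).1 huv with h | ⟨h1, h2⟩ | ⟨h1, h2⟩
      · exact (eq_empty_iff_forall_notMem.1 h0 e ⟨u, v, hu, hv, h⟩).elim
      · exact Or.inl ⟨hu.trans (congrArg _ h1), hv.trans (congrArg _ h2)⟩
      · exact Or.inr ⟨hu.trans (congrArg _ h1), hv.trans (congrArg _ h2)⟩
    let γ : Γ.Subdiagram :=
      { verts := {(s 0).1, (s 0).2}
        edges := Γ.fibreEdges (mergeMap s 1)
        src_mem := fun e he => (hends e he).elim (fun h => ⟨_, by simp, h.1⟩)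
          fun h => ⟨_, by simp, h.1⟩
        tgt_mem := fun e he => (hends e he).elim (fun h => ⟨_, by simp, h.2⟩)
          fun h => ⟨_, by simp, h.2⟩ }
    have hbubble : γ.IsBubble := ⟨(s 0).1, (s 0).2, hne, rfl, hcount 1 (by omega), hends⟩
    have hfull : γ.Full := by
      rintro e ⟨u, v, hu, hv, huv⟩ e' hs' ht'
      exact ⟨u, v, hs'.trans hu, ht'.trans hv, huv⟩
    refine IsNestedBubble.bubble Γ γ hbubble hfull ?_
    set r : Γ.I → Γ.I → Prop := fun v w => ∃ δ ∈ ({γ} : Set Γ.Subdiagram),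
      v ∈ δ.verts ∧ w ∈ δ.verts with hrdef
    have hr : ∀ u v, r u v ↔ (u = (s 0).1 ∨ u = (s 0).2) ∧ (v = (s 0).1 ∨ v = (s 0).2) := by
      intro u v
      rw [hrdef]
      constructor
      · rintro ⟨_, rfl, hu, hv⟩; exact ⟨hu, hv⟩
      · rintro ⟨hu, hv⟩; exact ⟨γ, rfl, hu, hv⟩
    have hq := quot_mk_eq_iff_mergeMap s hr
    set s' : ℕ → Quot r × Quot r := fun j => (Quot.mk r (s (j + 1)).1, Quot.mk r (s (j + 1)).2)
    have hcard : Nat.card (Quot r) = N + 1 := by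
      have h1 := ncard_range_mergeMap hs (i := 1) (by omega)
      have h2 : Nat.card (Quot r) = Nat.card (range (mergeMap s 1)) := by
        have hl : ∀ a b, r a b → mergeMap s 1 a = mergeMap s 1 b := fun a b hab =>
          (hq 0 a b).1 (Quot.sound hab)
        refine Nat.card_eq_of_bijective (Quot.lift
          (fun a => (⟨mergeMap s 1 a, mem_range_self a⟩ : range (mergeMap s 1)))
          fun a b hab => Subtype.ext (hl a b hab)) ⟨?_, ?_⟩
        · rintro ⟨a⟩ ⟨b⟩ hab
          exact (hq 0 a b).2 (congrArg Subtype.val hab)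
        · rintro ⟨_, a, rfl⟩
          exact ⟨Quot.mk r a, rfl⟩
      rw [h2, Nat.card_coe_set_eq]
      omega
    refine ih (Γ.contract {γ}) (hlegs.contract _) hL hcard s' ?_ ?_
    · intro i hi heq
      exact hs (i + 1) (by omega) ((hq i _ _).1 heq)
    · intro i hi
      -- The edges merged so far are the two of the contracted bubble and those merged in the
      -- quotient.
      have hsplit : Γ.fibreEdges (mergeMap s (i + 1)) = Γ.fibreEdges (mergeMap s 1) ∪
          Subtype.val '' (Γ.contract {γ}).fibreEdges (mergeMap s' i) := by
        ext e
        constructor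
        · rintro ⟨u, v, hu, hv, huv⟩
          by_cases he : e ∈ Γ.fibreEdges (mergeMap s 1)
          · exact Or.inl he
          · refine Or.inr ⟨⟨e, ?_⟩, ⟨Quot.mk r u, Quot.mk r v, ?_, ?_, (hq i u v).2 huv⟩, rfl⟩
            · rintro _ rfl; exact he
            · exact congrArg (Sum.map (Quot.mk _) id) hu
            · exact congrArg (Sum.map (Quot.mk _) id) hv
        · rintro (⟨u, v, hu, hv, huv⟩ | ⟨⟨e, he⟩, ⟨u, v, hu, hv, huv⟩, rfl⟩)
          · exact ⟨u, v, hu, hv, mergeMap_eq_mono s (by omega) huv⟩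
          · change Sum.map (Quot.mk r) id (Γ.src e) = Sum.inl u at hu
            change Sum.map (Quot.mk r) id (Γ.tgt e) = Sum.inl v at hv
            rcases hsrc : Γ.src e with u' | l
            · rcases htgt : Γ.tgt e with v' | l
              · rw [hsrc] at hu
                rw [htgt] at hv
                obtain rfl := Sum.inl.inj hu
                obtain rfl := Sum.inl.inj hv
                exact ⟨u', v', hsrc, htgt, (hq i u' v').1 huv⟩
              · rw [htgt] at hv; cases hv
            · rw [hsrc] at hu; cases hu
      have hdisj : Disjoint (Γ.fibreEdges (mergeMap s 1))
          (Subtype.val '' (Γ.contract {γ}).fibreEdges (mergeMap s' i)) := by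
        rw [Set.disjoint_left]
        rintro _ he ⟨⟨e, he'⟩, _, rfl⟩
        exact he' γ rfl he
      have h1 := hcount (i + 1) (by omega)
      have h2 := hcount 1 (by omega)
      have h3 : (Subtype.val '' (Γ.contract {γ}).fibreEdges (mergeMap s' i)).ncard =
          ((Γ.contract {γ}).fibreEdges (mergeMap s' i)).ncard :=
        ncard_image_of_injective _ Subtype.val_injective
      rw [hsplit, ncard_union_eq hdisj (toFinite _) (toFinite _)] at h1
      omega

end FeynmanDiagram
-- Bounds on tested valuations.
theorem lintegral_fin_prod {n : ℕ} (f : Fin n → Torus → ENNReal) (hf : ∀ i, Measurable (f i)) :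
    ∫⁻ x : Fin n → Torus, ∏ i, f i (x i) = ∏ i, ∫⁻ t, f i t := by
  induction n with
  | zero => simp [volume_pi]
  | succ n ih =>
    have hm := volume_preserving_piFinSuccAbove (fun _ : Fin (n + 1) => Torus) 0
    have hmeas : Measurable fun x : Fin (n + 1) → Torus => ∏ i, f i (x i) :=
      Finset.measurable_prod _ fun i _ => (hf i).comp (measurable_pi_apply i)
    have hmeas' : Measurable fun x : Fin n → Torus => ∏ i, f i.succ (x i) :=
      Finset.measurable_prod _ fun i _ => (hf i.succ).comp (measurable_pi_apply i)
    rw [← hm.symm.lintegral_comp hmeas, Measure.volume_eq_prod, Fin.prod_univ_succ,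
      ← ih (fun i => f i.succ) fun i => hf i.succ, ← lintegral_prod_mul (hf 0).aemeasurable
        hmeas'.aemeasurable]
    refine lintegral_congr fun p => ?_
    rw [Fin.prod_univ_succ]
    simp [MeasurableEquiv.piFinSuccAbove_symm_apply]

theorem lintegral_pi_prod {ι : Type} [Fintype ι] (f : ι → Torus → ENNReal)
    (hf : ∀ i, Measurable (f i)) :
    ∫⁻ x : ι → Torus, ∏ i, f i (x i) = ∏ i, ∫⁻ t, f i t := by
  let e : Fin (Fintype.card ι) ≃ ι := (Fintype.equivFin ι).symm
  have hm := volume_measurePreserving_piCongrLeft (fun _ : ι => Torus) e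
  have hmeas : Measurable fun x : ι → Torus => ∏ i, f i (x i) :=
    Finset.measurable_prod _ fun i _ => (hf i).comp (measurable_pi_apply i)
  rw [← hm.lintegral_comp hmeas, ← e.prod_comp fun i => ∫⁻ t, f i t,
    ← lintegral_fin_prod (fun i => f (e i)) fun i => hf (e i)]
  refine lintegral_congr fun x => ?_
  rw [← e.prod_comp]
  refine Finset.prod_congr rfl fun i _ => ?_
  rw [MeasurableEquiv.piCongrLeft_apply_apply e (β := fun _ => Torus) x i]

theorem enorm_finset_prod {ι : Type} (s : Finset ι) (f : ι → ℝ) :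
    ‖∏ i ∈ s, f i‖ₑ = ∏ i ∈ s, ‖f i‖ₑ := by
  classical
  induction s using Finset.induction_on with
  | empty => simp
  | insert a s ha ih => rw [Finset.prod_insert ha, Finset.prod_insert ha, enorm_mul, ih]

/-- The power `-2` is integrable in dimension four: this is the ball estimate with `S = 2` and
radius 4, a ball that is the whole torus. The constant is `400 * 5 ^ 2`. -/
theorem lintegral_leg_le {A ε : ℝ} (hA : 0 < A) (hε : 0 < ε) (hε1 : ε < 1) (c : Torus) :
    ∫⁻ t : Torus, ENNReal.ofReal (A * ((‖t - c‖ + ε) ^ 2)⁻¹) ≤ ENNReal.ofReal (A * 10000) := by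
  rw [lintegral_sub_right_eq_self (fun t : Torus => ENNReal.ofReal (A * ((‖t‖ + ε) ^ 2)⁻¹)) c]
  simp_rw [ENNReal.ofReal_mul hA.le]
  rw [lintegral_const_mul _ (by fun_prop)]
  refine mul_le_mul_right ?_ _
  have h := lintegral_ball_pow_le ε 4 hε hε1 (by norm_num) le_rfl 2
  have huniv : Metric.closedBall (0 : Torus) 4 = univ := by
    rw [eq_univ_iff_forall]
    intro t
    simpa using (torus_norm_le t).trans Real.pi_le_four
  rw [huniv, Measure.restrict_univ] at h
  have e1 : ∀ t : Torus, (‖t‖ + ε) ^ (((2 : ℕ) : ℤ) - 4) = ((‖t‖ + ε) ^ 2)⁻¹ := by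
    intro t
    rw [show (((2 : ℕ) : ℤ) - 4) = -((2 : ℕ) : ℤ) by norm_num, zpow_neg, zpow_natCast]
  simp_rw [e1] at h
  refine h.trans (ENNReal.ofReal_le_ofReal ?_)
  rw [if_neg (by norm_num)]
  nlinarith

theorem IsSmooth.exists_bound {L : Type} [Fintype L] {φ : (L → Torus) → ℝ} (hφ : IsSmooth φ) :
    ∃ M, ∀ x, |φ x| ≤ M := by
  have hc := hφ.continuous
  obtain ⟨M, hM⟩ := (isCompact_closedBall (0 : L → Fin 4 → ℝ) Real.pi).exists_bound_of_continuousOn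
    hc.continuousOn
  refine ⟨M, fun x => ?_⟩
  choose ξ hξ hξ' using fun l => exists_representative (x l)
  have hmem : (fun l i => ξ l i) ∈ Metric.closedBall (0 : L → Fin 4 → ℝ) Real.pi := by
    rw [mem_closedBall_zero_iff, pi_norm_le_iff_of_nonneg Real.pi_pos.le]
    intro l
    rw [pi_norm_le_iff_of_nonneg Real.pi_pos.le]
    intro i
    exact hξ' l i
  have hx : (fun l i => ((ξ l i : ℝ) : AddCircle (2 * Real.pi))) = x := funext fun l => hξ l
  have := hM _ hmem
  simp only [hx] at this
  exact this

theorem IsSmooth.abs_le_iSup {L : Type} [Fintype L] {φ : (L → Torus) → ℝ} (hφ : IsSmooth φ)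
    (x : L → Torus) : |φ x| ≤ ⨆ x, |φ x| := by
  obtain ⟨M, hM⟩ := hφ.exists_bound
  exact le_ciSup (f := fun x => |φ x|) ⟨M, by rintro _ ⟨y, rfl⟩; exact hM y⟩ x

namespace FeynmanDiagram

theorem val_eq_of_not_pinned (Γ : FeynmanDiagram) (h : ∀ v, ¬ Γ.Pinned v)
    (ρ : EuclideanSpace ℝ (Fin 4) → ℝ) (ε : ℝ) (x : Γ.L → Torus) :
    Γ.val ρ ε x = ∫ y : Γ.I → Torus,
      ∏ e, greenMoll ρ ε (Sum.elim y x (Γ.tgt e) - Sum.elim y x (Γ.src e)) := by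
  let f : Γ.Free ≃ Γ.I := Equiv.subtypeUnivEquiv h
  have hm := volume_measurePreserving_piCongrLeft (fun _ : Γ.I => Torus) f
  rw [← hm.integral_comp']
  unfold val
  congr 1
  funext y
  have hpos : ∀ w, Γ.position y x w =
      Sum.elim (MeasurableEquiv.piCongrLeft (fun _ : Γ.I => Torus) f y) x w := by
    rintro (v | l)
    · have := MeasurableEquiv.piCongrLeft_apply_apply f (β := fun _ => Torus) y ⟨v, h v⟩
      simp only [position, dif_neg (h v), Sum.elim_inl]
      exact this.symm
    · rfl
  simp only [hpos]

theorem contract_empty_reachable (Γ : FeynmanDiagram) {a b : Γ.I ⊕ Γ.L}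
    (h : Γ.graph.Reachable a b) :
    (Γ.contract ∅).graph.Reachable (Sum.map (Quot.mk _) id a) (Sum.map (Quot.mk _) id b) := by
  have hc : (Γ.contract ∅).graph.connectedComponentMk (Sum.map (Quot.mk _) id a) =
      (Γ.contract ∅).graph.connectedComponentMk (Sum.map (Quot.mk _) id b) := by
    refine eq_of_reachable Γ (fun w => (Γ.contract ∅).graph.connectedComponentMk
      (Sum.map (Quot.mk _) id w)) (fun e => ?_) h
    exact SimpleGraph.ConnectedComponent.sound
      ((Γ.contract ∅).reachable_of_edge ⟨e, fun γ hγ => hγ.elim⟩)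
  exact SimpleGraph.ConnectedComponent.exact hc

/-- Contracting nothing still replaces the vertex and edge types by a quotient and a subtype, so the
integral has to be transported. Reachability of a leaf rules out pinned vertices on both sides. -/
theorem val_contract_empty (Γ : FeynmanDiagram)
    (h : ∀ v, ∃ l, Γ.graph.Reachable (Sum.inl v) (Sum.inr l))
    (ρ : EuclideanSpace ℝ (Fin 4) → ℝ) (ε : ℝ) (x : Γ.L → Torus) :
    (Γ.contract ∅).val ρ ε x = Γ.val ρ ε x := by
  refine ((Γ.contract ∅).val_eq_of_not_pinned ?_ ρ ε x).trans (Eq.trans ?_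
    (Γ.val_eq_of_not_pinned (fun v hv => (h v).elim fun l hl => hv.1 l hl) ρ ε x).symm)
  · rintro ⟨v⟩ hv
    obtain ⟨l, hl⟩ := h v
    exact hv.1 l (Γ.contract_empty_reachable hl)
  let mk : Γ.I → (Γ.contract ∅).I := Quot.mk _
  have hmk : Function.Bijective mk := by
    constructor
    · intro a b hab
      exact congrArg (Quot.lift id fun u v huv => huv.elim fun γ hγ => hγ.1.elim) hab
    · rintro ⟨a⟩
      exact ⟨a, rfl⟩
  let f : Γ.I ≃ (Γ.contract ∅).I := Equiv.ofBijective mk hmk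
  have hm := volume_measurePreserving_piCongrLeft (fun _ : (Γ.contract ∅).I => Torus) f
  rw [← hm.integral_comp']
  congr 1
  funext y
  let toE : Γ.E → (Γ.contract ∅).E := fun e => ⟨e, fun γ hγ => hγ.elim⟩
  have hE : Function.Bijective toE := by
    refine ⟨fun a b hab => congrArg Subtype.val hab, ?_⟩
    rintro ⟨e, he⟩
    exact ⟨e, rfl⟩
  refine (hE.prod_comp _).symm.trans ?_
  have hpos : ∀ w : Γ.I ⊕ Γ.L, Sum.elim (MeasurableEquiv.piCongrLeft
      (fun _ : (Γ.contract ∅).I => Torus) f y) x (Sum.map mk id w) = Sum.elim y x w := by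
    rintro (v | l)
    · exact MeasurableEquiv.piCongrLeft_apply_apply f (β := fun _ => Torus) y v
    · rfl
  refine Finset.prod_congr rfl fun e _ => ?_
  rw [← hpos, ← hpos]
  rfl

/-- No subdiagram has negative degree, so the forest formula reduces to the term of the empty
forest. -/
theorem IsPositive.renVal_eq {Γ : FeynmanDiagram} (hpos : Γ.IsPositive)
    (h : ∀ v, ∃ l, Γ.graph.Reachable (Sum.inl v) (Sum.inr l))
    (ρ : EuclideanSpace ℝ (Fin 4) → ℝ) (ε : ℝ) (x : Γ.L → Torus) :
    Γ.renVal ρ ε x = Γ.val ρ ε x := by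
  have hf : Γ.forests = {∅} := by
    ext F
    simp only [forests, Finset.mem_filter, Finset.mem_univ, true_and, Finset.mem_singleton]
    constructor
    · rintro ⟨h1, _⟩
      refine Finset.eq_empty_of_forall_notMem fun γ hγ => ?_
      exact absurd (h1 γ hγ).2.2 (not_lt.2 (hpos.degree_nonneg γ))
    · rintro rfl
      simp
  have hroots : roots (∅ : Finset Γ.Subdiagram) = ∅ := by
    rw [eq_empty_iff_forall_notMem]
    intro γ hγ
    exact absurd hγ.1 (by simp)
  unfold renVal valExtract
  rw [hf, Finset.sum_singleton, hroots]
  simp [Γ.val_contract_empty h]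

theorem HasLegs.exists_vertex {Γ : FeynmanDiagram} (h : Γ.HasLegs) (l : Γ.L) :
    ∃ e v, (Γ.src e = Sum.inr l ∧ Γ.tgt e = Sum.inl v) ∨
      (Γ.src e = Sum.inl v ∧ Γ.tgt e = Sum.inr l) := by
  obtain ⟨e, he, _⟩ := h.leaf l
  rcases h.edge e with ⟨⟨u, hu⟩, v, hv⟩ | ⟨l', v, hl, hv⟩ | ⟨v, l', hv, hl⟩
  · simp [hu, hv] at he
  · refine ⟨e, v, Or.inl ⟨?_, hv⟩⟩
    simpa [hl, hv] using he
  · refine ⟨e, v, Or.inr ⟨hv, ?_⟩⟩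
    simpa [hl, hv] using he

/-- The edges of a diagram are its legs, labelled by the leaves, and its internal edges. -/
theorem HasLegs.exists_bijective {Γ : FeynmanDiagram} (h : Γ.HasLegs) :
    ∃ (leg : Γ.L → Γ.E) (att : Γ.L → Γ.I),
      (∀ l, (Γ.src (leg l) = Sum.inr l ∧ Γ.tgt (leg l) = Sum.inl (att l)) ∨
        (Γ.src (leg l) = Sum.inl (att l) ∧ Γ.tgt (leg l) = Sum.inr l)) ∧
      Function.Bijective (Sum.elim leg (Subtype.val : Γ.intEdges → Γ.E)) := by
  choose leg att hleg using h.exists_vertex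
  have hnot : ∀ l, leg l ∉ Γ.intEdges := by
    rintro l ⟨⟨u, hu⟩, v, hv⟩
    have := hleg l
    simp [hu, hv] at this
  refine ⟨leg, att, hleg, ?_, ?_⟩
  · rintro (l | e) (l' | e') hab
    · simp only [Sum.elim_inl] at hab
      have h1 := hleg l
      have h2 := hleg l'
      rw [hab] at h1
      grind
    · exact (hnot l (by simp only [Sum.elim_inl, Sum.elim_inr] at hab; rw [hab]; exact e'.2)).elim
    · exact (hnot l' (by simp only [Sum.elim_inl, Sum.elim_inr] at hab; rw [← hab]; exact e.2)).elim
    · exact congrArg Sum.inr (Subtype.ext hab)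
  · intro e
    by_cases he : e ∈ Γ.intEdges
    · exact ⟨Sum.inr ⟨e, he⟩, rfl⟩
    · have : ∃ l, Γ.src e = Sum.inr l ∨ Γ.tgt e = Sum.inr l := by
        rcases h.edge e with h | ⟨l, v, hl, _⟩ | ⟨v, l, _, hl⟩
        · exact (he h).elim
        · exact ⟨l, Or.inl hl⟩
        · exact ⟨l, Or.inr hl⟩
      obtain ⟨l, hl⟩ := this
      refine ⟨Sum.inl l, (h.leaf l).unique ?_ hl⟩
      exact (hleg l).imp (fun h => h.1) fun h => h.2

theorem HasLegs.card_edges {Γ : FeynmanDiagram} (h : Γ.HasLegs) :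
    Nat.card Γ.E = Nat.card Γ.L + Γ.numIntEdges := by
  obtain ⟨leg, att, _, hb⟩ := h.exists_bijective
  rw [← Nat.card_eq_of_bijective _ hb, Nat.card_sum]
  rfl

/-- The bound on tested valuations: one factor `logFactor ε` for each degree zero scale. -/
theorem exists_valTest_le {ρ : EuclideanSpace ℝ (Fin 4) → ℝ} (hρ : IsMollifier ρ) (N m d : ℕ) :
    ∃ C : ℝ, 0 ≤ C ∧ ∀ Γ : FeynmanDiagram, Γ.HasLegs → (∀ v, ¬ Γ.Pinned v) →
      Nat.card Γ.I = N + 1 → Nat.card Γ.L = d → Γ.numIntEdges = m → ∀ Z : ℕ,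
      (∀ s, MergeIndep s N → ∀ i ≤ N, mergedCount Γ.intSrc Γ.intTgt s i ≤ 2 * i) →
      (∀ s, MergeIndep s N →
        numZeros (fun i => 4 * i - 2 * mergedCount Γ.intSrc Γ.intTgt s i) N ≤ Z) →
      ∀ (φ : (Γ.L → Torus) → ℝ) (M : ℝ), (∀ x, |φ x| ≤ M) → ∀ ε : ℝ, 0 < ε → ε < 1 →
        |Γ.valTest ρ ε φ| ≤ C * M * logFactor ε ^ Z := by
  classical
  obtain ⟨A, hA, hG⟩ := exists_greenMoll_le hρ
  refine ⟨(A * 10000) ^ d * (A ^ m * (((N + 1) ^ 2) ^ N * (volume (univ : Set Torus)).toReal *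
    (400 ^ N * 5 ^ (4 * N)))), by positivity, ?_⟩
  intro Γ hlegs hpin hI hL hm Z hdeg hZ φ M hM ε hε hε1
  have hlf := one_le_logFactor hε hε1
  have hM0 : 0 ≤ M := (abs_nonneg _).trans (hM fun _ => 0)
  obtain ⟨leg, att, hleg, hb⟩ := hlegs.exists_bijective
  set K : Torus → ENNReal := fun t => ENNReal.ofReal (A * ((‖t‖ + ε) ^ 2)⁻¹) with hK
  have hKm : Measurable K := by rw [hK]; fun_prop
  have hKneg : ∀ a b, K (a - b) = K (b - a) := by
    intro a b; simp only [hK, norm_sub_rev]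
  have hprod : ∀ (y : Γ.I → Torus) (x : Γ.L → Torus),
      ‖∏ e, greenMoll ρ ε (Sum.elim y x (Γ.tgt e) - Sum.elim y x (Γ.src e))‖ₑ ≤
        (∏ l, K (x l - y (att l))) * ∏ e, K (y (Γ.intSrc e) - y (Γ.intTgt e)) := by
    intro y x
    rw [enorm_finset_prod]
    refine (Finset.prod_le_prod' fun e _ => hG ε hε hε1 _).trans (le_of_eq ?_)
    rw [← hb.prod_comp, Fintype.prod_sum_type]
    congr 1
    · refine Finset.prod_congr rfl fun l _ => ?_
      rw [Sum.elim_inl]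
      rcases hleg l with ⟨h1, h2⟩ | ⟨h1, h2⟩
      · rw [h1, h2, Sum.elim_inl, Sum.elim_inr]; exact hKneg _ _
      · rw [h1, h2, Sum.elim_inl, Sum.elim_inr]
    · refine Finset.prod_congr rfl fun e _ => ?_
      rw [Sum.elim_inr, Γ.src_eq_intSrc, Γ.tgt_eq_intTgt, Sum.elim_inl, Sum.elim_inl]
      exact hKneg _ _
  have hint : ∀ y : Γ.I → Torus, ∏ e, K (y (Γ.intSrc e) - y (Γ.intTgt e)) =
      ENNReal.ofReal (A ^ m) *
        ∏ e, ENNReal.ofReal (((‖y (Γ.intSrc e) - y (Γ.intTgt e)‖ + ε) ^ 2)⁻¹) := by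
    intro y
    have hcard : Fintype.card Γ.intEdges = m := by
      rw [← hm, numIntEdges, ← Nat.card_coe_set_eq, Nat.card_eq_fintype_card]
    simp only [hK, ENNReal.ofReal_mul hA.le]
    rw [Finset.prod_mul_distrib, Finset.prod_const, Finset.card_univ, hcard,
      ENNReal.ofReal_pow hA.le]
  have hIm : Measurable fun y : Γ.I → Torus => ∏ e, K (y (Γ.intSrc e) - y (Γ.intTgt e)) := by
    refine Finset.measurable_prod _ fun e _ => hKm.comp ?_
    fun_prop
  have hLm : Measurable fun p : (Γ.L → Torus) × (Γ.I → Torus) =>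
      ∏ l, K (p.1 l - p.2 (att l)) := by
    refine Finset.measurable_prod _ fun l _ => hKm.comp ?_
    fun_prop
  have hbound : ‖Γ.valTest ρ ε φ‖ₑ ≤ ENNReal.ofReal ((A * 10000) ^ d *
      (A ^ m * (((N + 1) ^ 2) ^ N * (volume (univ : Set Torus)).toReal *
        (400 ^ N * 5 ^ (4 * N)))) * M * logFactor ε ^ Z) := by
    calc ‖Γ.valTest ρ ε φ‖ₑ
        ≤ ∫⁻ x : Γ.L → Torus, ‖Γ.val ρ ε x * φ x‖ₑ := enorm_integral_le_lintegral_enorm _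
      _ ≤ ∫⁻ x : Γ.L → Torus, ENNReal.ofReal M * ∫⁻ y : Γ.I → Torus,
            (∏ l, K (x l - y (att l))) * ∏ e, K (y (Γ.intSrc e) - y (Γ.intTgt e)) := by
          refine lintegral_mono fun x => ?_
          rw [enorm_mul, mul_comm]
          refine mul_le_mul' ?_ ?_
          · rw [← ofReal_norm]
            exact ENNReal.ofReal_le_ofReal (hM x)
          · rw [Γ.val_eq_of_not_pinned hpin]
            exact (enorm_integral_le_lintegral_enorm _).trans (lintegral_mono fun y => hprod y x)
      -- With the internal vertices fixed, the leaf variables decouple, and each leg is integrated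
      -- out by `lintegral_leg_le`.
      _ = ENNReal.ofReal M * ∫⁻ y : Γ.I → Torus, ∫⁻ x : Γ.L → Torus,
            (∏ l, K (x l - y (att l))) * ∏ e, K (y (Γ.intSrc e) - y (Γ.intTgt e)) := by
          rw [lintegral_const_mul' _ _ ENNReal.ofReal_ne_top, lintegral_lintegral_swap]
          exact (hLm.mul (hIm.comp measurable_snd)).aemeasurable
      _ ≤ ENNReal.ofReal M * ∫⁻ y : Γ.I → Torus, ENNReal.ofReal ((A * 10000) ^ d * A ^ m) *
            ∏ e, ENNReal.ofReal (((‖y (Γ.intSrc e) - y (Γ.intTgt e)‖ + ε) ^ 2)⁻¹) := by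
          refine mul_le_mul_right (lintegral_mono fun y => ?_) _
          have hKc : ∀ c, Measurable fun t => K (t - c) := fun c => hKm.comp (by fun_prop)
          have hLy : Measurable fun x : Γ.L → Torus => ∏ l, K (x l - y (att l)) :=
            Finset.measurable_prod _ fun l _ => (hKc _).comp (measurable_pi_apply l)
          rw [lintegral_mul_const _ hLy,
            lintegral_pi_prod (fun l t => K (t - y (att l))) fun l => hKc _,
            hint y, ENNReal.ofReal_mul (by positivity), mul_assoc]
          refine mul_le_mul_left ?_ _
          refine (Finset.prod_le_prod' fun l _ => lintegral_leg_le hA hε hε1 (y (att l))).trans ?_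
          rw [Finset.prod_const, Finset.card_univ, ← Nat.card_eq_fintype_card, hL,
            ENNReal.ofReal_pow (by positivity)]
      _ ≤ _ := by
          rw [lintegral_const_mul' _ _ ENNReal.ofReal_ne_top]
          refine (mul_le_mul_right (mul_le_mul_right
            (lintegral_graph_le hI Γ.intSrc Γ.intTgt Z hdeg hZ hε hε1) _) _).trans ?_
          rw [← ENNReal.ofReal_mul (by positivity), ← ENNReal.ofReal_mul hM0]
          refine ENNReal.ofReal_le_ofReal (le_of_eq ?_)
          ring
  have hnn : 0 ≤ logFactor ε := by linarith
  rw [← ofReal_norm, ENNReal.ofReal_le_ofReal_iff (by positivity)] at hbound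
  exact hbound

end FeynmanDiagram
-- Counting the zero degree scales.
-- At a zero scale `e i = 2 * i`, which is at least twice the number of zeros up to `i`; between
-- zeros, monotonicity suffices. The second conjunct serves the induction.
theorem two_mul_numZeros_le {e : ℕ → ℕ} (hmono : Monotone e) {N : ℕ} (he : ∀ i ≤ N, e i ≤ 2 * i) :
    2 * numZeros (fun i => 4 * i - 2 * e i) N ≤ e N ∧
      numZeros (fun i => 4 * i - 2 * e i) N ≤ N := by
  induction N with
  | zero => simp [numZeros]
  | succ N ih =>
    have h1 := ih fun i hi => he i (by omega)
    have h2 : e N ≤ e (N + 1) := hmono (Nat.le_succ N)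
    have h3 := he (N + 1) le_rfl
    rw [numZeros_succ]
    split_ifs with h <;> omega

/-- If the last scale were not a zero, the earlier ones would give twice their number `≤ e (N - 1) <
e N`. So it is a zero, `e N = 2 * N`, and equality makes all `N` scales zeros. -/
theorem eq_two_mul_of_two_mul_numZeros_eq {e : ℕ → ℕ} (hmono : Monotone e) {N : ℕ}
    (he : ∀ i ≤ N, e i ≤ 2 * i) (hlast : ∀ i, i + 1 = N → e i < e N)
    (heq : 2 * numZeros (fun i => 4 * i - 2 * e i) N = e N) : ∀ i ≤ N, e i = 2 * i := by
  have hN : numZeros (fun i => 4 * i - 2 * e i) N = N := by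
    rcases N with _ | N
    · simp [numZeros]
    · have h1 := (two_mul_numZeros_le hmono fun i (hi : i ≤ N) => he i (by omega)).1
      have h2 := hlast N rfl
      have h3 := he (N + 1) le_rfl
      rw [numZeros_succ] at heq ⊢
      split_ifs at heq ⊢ with h <;> omega
  intro i hi
  rcases i with _ | i
  · have := he 0 (Nat.zero_le _)
    omega
  · unfold numZeros at hN
    have h1 : 4 * (i + 1) - 2 * e (i + 1) = 0 := Finset.card_filter_eq_iff.1 (hN.trans (Finset.card_range N).symm) i
      (Finset.mem_range.2 hi)
    have h2 := he (i + 1) hi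
    omega

theorem mergedCount_monotone {V E : Type} [Finite E] (p q : E → V) (s : ℕ → V × V) :
    Monotone (mergedCount p q s) :=
  monotone_nat_of_le_succ fun i => by rw [mergedCount_succ]; omega

namespace FeynmanDiagram

theorem mergedCount_eq_numIntEdges (Γ : FeynmanDiagram) {N : ℕ} (hI : Nat.card Γ.I = N + 1)
    {s : ℕ → Γ.I × Γ.I} (hs : MergeIndep s N) :
    mergedCount Γ.intSrc Γ.intTgt s N = Γ.numIntEdges := by
  unfold mergedCount numIntEdges
  have : {e | mergeMap s N (Γ.intSrc e) = mergeMap s N (Γ.intTgt e)} = univ :=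
    eq_univ_of_forall fun e => mergeMap_eq_of_card hs hI _ _
  rw [this, ncard_univ, Nat.card_coe_set_eq]

theorem HasLegs.eq_of_connected {Γ : FeynmanDiagram} (h : Γ.HasLegs) (hc : Γ.Connected)
    {α : Type} (f : Γ.I → α) (hf : ∀ e, f (Γ.intSrc e) = f (Γ.intTgt e)) (u v : Γ.I) :
    f u = f v := by
  obtain ⟨leg, att, hleg, hb⟩ := h.exists_bijective
  refine eq_of_reachable Γ (Sum.elim f fun l => f (att l)) (fun e => ?_)
    (hc.preconnected (Sum.inl u) (Sum.inl v))
  obtain ⟨l | e, rfl⟩ := hb.surjective e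
  · rw [Sum.elim_inl]
    rcases hleg l with ⟨h1, h2⟩ | ⟨h1, h2⟩ <;> rw [h1, h2] <;> rfl
  · rw [Sum.elim_inr, src_eq_intSrc, tgt_eq_intTgt]
    exact hf e

/-- Before the last merge two classes remain. Legs are dangling, so connectedness forces an internal
edge between these classes, and it is absorbed only at the end. -/
theorem HasLegs.mergedCount_lt_of_connected {Γ : FeynmanDiagram} (h : Γ.HasLegs)
    (hc : Γ.Connected) {N : ℕ} (hI : Nat.card Γ.I = N + 1) {s : ℕ → Γ.I × Γ.I}
    (hs : MergeIndep s N) {i : ℕ} (hi : i + 1 = N) :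
    mergedCount Γ.intSrc Γ.intTgt s i < mergedCount Γ.intSrc Γ.intTgt s N := by
  by_contra! hle
  rw [Γ.mergedCount_eq_numIntEdges hI hs, numIntEdges, ← Nat.card_coe_set_eq] at hle
  have huniv : {e | mergeMap s i (Γ.intSrc e) = mergeMap s i (Γ.intTgt e)} = univ := by
    refine eq_of_subset_of_ncard_le (subset_univ _) ?_ (toFinite _)
    rw [ncard_univ]
    exact hle
  refine hs i (by omega) (h.eq_of_connected hc (mergeMap s i) (fun e => ?_) _ _)
  exact (eq_univ_iff_forall.1 huniv e :)

/-- In a connected diagram that is not a nested bubble diagram with four legs, each degree zero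
scale uses up more than two internal edges on average. -/
theorem HasLegs.two_mul_numZeros_lt {Γ : FeynmanDiagram} (h : Γ.HasLegs) (hc : Γ.Connected)
    (hdeg : ∀ γ : Γ.Subdiagram, 0 ≤ γ.degree) {k : ℕ} (hL : Nat.card Γ.L = 2 * k)
    (hIE : 2 * Nat.card Γ.I = k + Γ.numIntEdges) (hnb : k ≠ 2 ∨ ¬ Γ.IsNestedBubble)
    {N : ℕ} (hI : Nat.card Γ.I = N + 1) {s : ℕ → Γ.I × Γ.I} (hs : MergeIndep s N) :
    2 * numZeros (fun i => 4 * i - 2 * mergedCount Γ.intSrc Γ.intTgt s i) N <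
      Γ.numIntEdges := by
  have hmono := mergedCount_monotone Γ.intSrc Γ.intTgt s
  have he : ∀ i ≤ N, mergedCount Γ.intSrc Γ.intTgt s i ≤ 2 * i := fun i hi =>
    mergedCount_le_of_degree_nonneg hdeg hs hi
  have hN := Γ.mergedCount_eq_numIntEdges hI hs
  have hle := (two_mul_numZeros_le hmono he).1
  rw [hN] at hle
  refine lt_of_le_of_ne hle fun heq => ?_
  have hall := eq_two_mul_of_two_mul_numZeros_eq hmono he
    (fun i hi => h.mergedCount_lt_of_connected hc hI hs hi) (heq.trans hN.symm)
  have hk : k = 2 := by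
    have := hall N le_rfl
    omega
  refine hnb.elim (fun h => h hk) fun h' => h' ?_
  refine isNestedBubble_of_mergedCount N Γ h (by rw [hL, hk]) hI s hs fun i hi => ?_
  rw [← mergedCount_eq_ncard]
  exact hall i hi

end FeynmanDiagram

/-! ### Combinatorics of the paired linear trees. -/

section Paired

variable {k : ℕ} {n : Fin k → ℕ} (κ : Pairing n)

theorem paired_src_zero (i : Fin k) : (paired n κ).src ⟨i, 0⟩ = Sum.inr (i, false) := rfl

theorem paired_src_succ (i : Fin k) (j : Fin (n i)) :
    (paired n κ).src ⟨i, j.succ⟩ = Sum.inl (Quot.mk _ ⟨i, j⟩) := rfl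

theorem paired_tgt_last (i : Fin k) :
    (paired n κ).tgt ⟨i, Fin.last _⟩ = Sum.inr (i, true) := by
  simp only [paired, Fin.lastCases_last]

theorem paired_tgt_castSucc (i : Fin k) (j : Fin (n i)) :
    (paired n κ).tgt ⟨i, j.castSucc⟩ = Sum.inl (Quot.mk _ ⟨i, j⟩) := by
  simp only [paired, Fin.lastCases_castSucc]

theorem paired_src_eq_inr {e : (paired n κ).E} {l : Fin k × Bool}
    (h : (paired n κ).src e = Sum.inr l) : e = ⟨l.1, 0⟩ ∧ l.2 = false := by
  obtain ⟨i, j⟩ := e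
  induction j using Fin.cases with
  | zero =>
    rw [paired_src_zero] at h
    obtain rfl := Sum.inr.inj h
    exact ⟨rfl, rfl⟩
  | succ j => rw [paired_src_succ] at h; cases h

theorem paired_tgt_eq_inr {e : (paired n κ).E} {l : Fin k × Bool}
    (h : (paired n κ).tgt e = Sum.inr l) : e = ⟨l.1, Fin.last _⟩ ∧ l.2 = true := by
  obtain ⟨i, j⟩ := e
  induction j using Fin.lastCases with
  | last =>
    rw [paired_tgt_last] at h
    obtain rfl := Sum.inr.inj h
    exact ⟨rfl, rfl⟩
  | cast j => rw [paired_tgt_castSucc] at h; cases h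

theorem paired_hasLegs (hn : ∀ i, 1 ≤ n i) : (paired n κ).HasLegs where
  edge := by
    intro e
    rcases hs : (paired n κ).src e with v | l <;> rcases ht : (paired n κ).tgt e with w | l'
    · exact Or.inl ⟨⟨v, hs⟩, w, ht⟩
    · exact Or.inr (Or.inr ⟨v, l', rfl, rfl⟩)
    · exact Or.inr (Or.inl ⟨l, w, rfl, rfl⟩)
    · obtain ⟨rfl, _⟩ := paired_src_eq_inr κ hs
      obtain ⟨h2, _⟩ := paired_tgt_eq_inr κ ht
      obtain ⟨h3, h4⟩ := Sigma.mk.inj_iff.1 h2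
      rw [← h3] at h4
      have h5 := congrArg Fin.val (eq_of_heq h4)
      have h6 := hn l.1
      simp only [Fin.val_zero, Fin.val_last] at h5
      omega
  leaf := by
    rintro ⟨i, _ | _⟩
    · refine ⟨⟨i, 0⟩, Or.inl rfl, ?_⟩
      rintro e (he | he)
      · exact (paired_src_eq_inr κ he).1
      · exact absurd (paired_tgt_eq_inr κ he).2 (by simp)
    · refine ⟨⟨i, Fin.last _⟩, Or.inr (paired_tgt_last κ i), ?_⟩
      rintro e (he | he)
      · exact absurd (paired_src_eq_inr κ he).2 (by simp)
      · exact (paired_tgt_eq_inr κ he).1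

theorem paired_exists_reachable (v : (paired n κ).I) :
    ∃ l, (paired n κ).graph.Reachable (Sum.inl v) (Sum.inr l) := by
  obtain ⟨⟨i, j, hj⟩⟩ := v
  refine ⟨(i, false), ?_⟩
  induction j with
  | zero =>
    have h := (paired n κ).reachable_of_edge ⟨i, (⟨0, hj⟩ : Fin (n i)).castSucc⟩
    rw [paired_tgt_castSucc] at h
    exact h.symm
  | succ j ih =>
    have h := (paired n κ).reachable_of_edge ⟨i, (⟨j + 1, hj⟩ : Fin (n i)).castSucc⟩
    rw [paired_tgt_castSucc] at h
    exact h.symm.trans (ih (by omega))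

theorem paired_not_pinned (v : (paired n κ).I) : ¬ (paired n κ).Pinned v := fun h =>
  (paired_exists_reachable κ v).elim h.1

theorem paired_mk_eq_iff {a b : Σ i, Fin (n i)} :
    Quot.mk (fun a b : (Σ i, Fin (n i)) => b = κ.toFun a) a = Quot.mk _ b ↔
      a = b ∨ a = κ.toFun b := by
  constructor
  · intro h
    have hl : ∀ a b, b = κ.toFun a → ({a, κ.toFun a} : Set (Σ i, Fin (n i))) = {b, κ.toFun b} := by
      rintro a _ rfl
      rw [κ.involutive, Set.pair_comm]
    have h2 : ({a, κ.toFun a} : Set (Σ i, Fin (n i))) = {b, κ.toFun b} :=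
      congrArg (Quot.lift (fun a => ({a, κ.toFun a} : Set (Σ i, Fin (n i)))) hl) h
    have h3 : a ∈ ({b, κ.toFun b} : Set (Σ i, Fin (n i))) := h2 ▸ Set.mem_insert a _
    simpa using h3
  · rintro (rfl | rfl)
    · rfl
    · exact (Quot.sound (r := fun a b : (Σ i, Fin (n i)) => b = κ.toFun a) rfl).symm

theorem paired_two_mul_card : 2 * Nat.card (paired n κ).I = ∑ i, n i := by
  have hb : Function.Bijective fun p : (paired n κ).I × Bool =>
      if p.2 then Quot.out p.1 else κ.toFun (Quot.out p.1) := by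
    have hmk : ∀ p : (paired n κ).I × Bool, (Quot.mk _ (if p.2 then Quot.out p.1 else
        κ.toFun (Quot.out p.1)) : (paired n κ).I) = p.1 := by
      rintro ⟨q, _ | _⟩
      · exact ((paired_mk_eq_iff κ).2 (Or.inr rfl)).trans (Quot.out_eq q)
      · exact Quot.out_eq q
    constructor
    · intro p p' hpp
      have h1 : p.1 = p'.1 := by rw [← hmk p, ← hmk p']; exact congrArg _ hpp
      obtain ⟨q, b⟩ := p
      obtain ⟨q', b'⟩ := p'
      obtain rfl : q = q' := h1
      have hno := κ.no_fixed (Quot.out q)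
      rcases b with _ | _ <;> rcases b' with _ | _
      · rfl
      · exact absurd hpp hno
      · exact absurd hpp.symm hno
      · rfl
    · intro a
      rcases (paired_mk_eq_iff κ).1 (Quot.out_eq (Quot.mk _ a)) with h | h
      · exact ⟨(Quot.mk _ a, true), h⟩
      · refine ⟨(Quot.mk _ a, false), ?_⟩
        have := congrArg κ.toFun h
        rw [κ.involutive] at this
        exact this
  have h := Nat.card_eq_of_bijective _ hb
  rw [Nat.card_prod] at h
  simp only [Nat.card_eq_fintype_card (α := Bool), Fintype.card_bool,
    Nat.card_sigma, Nat.card_fin] at h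
  omega

theorem paired_card_leaves : Nat.card (paired n κ).L = 2 * k := by
  change Nat.card (Fin k × Bool) = 2 * k
  simp [mul_comm]

/-- Double counting: there are `∑ i, n i = 2|V⋆|` vertices before pairing, and `∑ i, n i + k` edges,
of which `2k` are legs. -/
theorem paired_two_mul_card_eq (hn : ∀ i, 1 ≤ n i) :
    2 * Nat.card (paired n κ).I = k + (paired n κ).numIntEdges := by
  have h1 := (paired_hasLegs κ hn).card_edges
  have h2 : Nat.card (paired n κ).E = ∑ i, n i + k := by
    change Nat.card (Σ i, Fin (n i + 1)) = _
    simp [Finset.sum_add_distrib]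
  rw [h2, paired_card_leaves] at h1
  have h3 := paired_two_mul_card κ
  omega

theorem paired_card_pos (hk : 1 ≤ k) (hn : ∀ i, 1 ≤ n i) : 0 < Nat.card (paired n κ).I := by
  have h1 := paired_two_mul_card κ
  have h2 : n ⟨0, hk⟩ ≤ ∑ i, n i := Finset.single_le_sum (fun _ _ => Nat.zero_le _)
    (Finset.mem_univ _)
  have h3 := hn ⟨0, hk⟩
  omega

end Paired

/-! ### Couplings against logarithms, and the conclusion. -/

theorem log_one_div_pos {ε : ℝ} (hε : 0 < ε) (hε1 : ε < 1) : 0 < Real.log (1 / ε) :=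
  Real.log_pos (by rw [lt_div_iff₀ hε]; linarith)

/-- With `σ = coupling 1 ε` one has `σ ^ 2 * logFactor ε = 1 + σ ^ 2`, so each logarithm uses up two
couplings. The remaining `m - 2 * Z` powers of `σ` tend to zero if there are any. -/
theorem coupling_pow_mul_logFactor_pow {lam ε : ℝ} (hε : 0 < ε) (hε1 : ε < 1) {m Z : ℕ}
    (h : 2 * Z ≤ m) :
    |coupling lam ε| ^ m * logFactor ε ^ Z =
      |lam| ^ m * ((1 + coupling 1 ε ^ 2) ^ Z * coupling 1 ε ^ (m - 2 * Z)) := by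
  have hL := log_one_div_pos hε hε1
  set σ := Real.log (1 / ε) ^ (-(1 / 2) : ℝ) with hσ
  have hσ0 : 0 < σ := Real.rpow_pos_of_pos hL _
  have h1 : coupling 1 ε = σ := one_mul _
  have h2 : |coupling lam ε| = |lam| * σ := by
    unfold coupling
    rw [abs_mul, abs_of_pos hσ0]
  have h3 : σ ^ 2 * logFactor ε = 1 + σ ^ 2 := by
    have : σ ^ 2 * Real.log (1 / ε) = 1 := by
      rw [hσ, ← Real.rpow_natCast, ← Real.rpow_mul hL.le,
        show (-(1 / 2) : ℝ) * (2 : ℕ) = -1 by norm_num, Real.rpow_neg_one,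
        inv_mul_cancel₀ hL.ne']
    unfold logFactor
    linarith
  rw [h1, h2, ← h3]
  obtain ⟨j, rfl⟩ := Nat.exists_eq_add_of_le h
  rw [Nat.add_sub_cancel_left]
  ring

theorem tendsto_coupling_one : Filter.Tendsto (coupling 1) (𝓝[>] 0) (𝓝 0) := by
  have h1 : Filter.Tendsto (fun ε : ℝ => Real.log (1 / ε)) (𝓝[>] 0) Filter.atTop := by
    simp only [one_div]
    exact Real.tendsto_log_atTop.comp tendsto_inv_nhdsGT_zero
  have h2 := (tendsto_rpow_neg_atTop (y := 1 / 2) (by norm_num)).comp h1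
  refine h2.congr fun ε => ?_
  simp [coupling]

theorem coupling_one_le {ε ε₀ : ℝ} (hε : 0 < ε) (hle : ε ≤ ε₀) (hε₀ : ε₀ < 1) :
    coupling 1 ε ≤ coupling 1 ε₀ := by
  unfold coupling
  have h0 : 0 < ε₀ := hε.trans_le hle
  simp only [one_mul]
  refine Real.rpow_le_rpow_of_nonpos (log_one_div_pos h0 hε₀) ?_ (by norm_num)
  exact Real.log_le_log (by positivity) (one_div_le_one_div_of_le hε hle)

theorem coupling_one_nonneg {ε : ℝ} (hε : 0 < ε) (hε1 : ε < 1) : 0 ≤ coupling 1 ε := by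
  unfold coupling
  rw [one_mul]
  exact Real.rpow_nonneg (log_one_div_pos hε hε1).le _

end AndersonFeynman

open AndersonFeynman in
theorem lemma4 (ρ : EuclideanSpace ℝ (Fin 4) → ℝ) (hρ : IsMollifier ρ) (k : ℕ) (hk : 1 ≤ k) :
    -- uniform bound for connected positive or zero degree diagrams
    (∀ (m : ℕ) (ε₀ : ℝ), 0 < ε₀ → ε₀ < 1 → ∃ C : ℝ,
      ∀ (n : Fin k → ℕ) (κ : Pairing n), (∀ i, 1 ≤ n i) →
        (paired n κ).Connected → ((paired n κ).IsPositive ∨ (paired n κ).IsZeroDegree) →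
        (paired n κ).numIntEdges = m →
        ∀ φ : (Fin k × Bool → Torus) → ℝ, IsSmooth φ →
        ∀ lam : ℝ, ∀ ε : ℝ, 0 < ε → ε ≤ ε₀ →
          |coupling lam ε| ^ m * |(paired n κ).valTest ρ ε φ| ≤
            C * (⨆ x, |φ x|) * |lam| ^ m) ∧
    -- only nested bubble diagrams with four legs can survive in the limit
    (∀ (n : Fin k → ℕ) (κ : Pairing n), (∀ i, 1 ≤ n i) →
        (paired n κ).Connected → ((paired n κ).IsPositive ∨ (paired n κ).IsZeroDegree) →
        (k ≠ 2 ∨ ¬ (paired n κ).IsNestedBubble) →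
        ∀ φ : (Fin k × Bool → Torus) → ℝ, IsSmooth φ → ∀ lam : ℝ,
          Filter.Tendsto
            (fun ε : ℝ => |coupling lam ε| ^ (paired n κ).numIntEdges *
              |(paired n κ).valTest ρ ε φ|)
            (𝓝[>] 0) (𝓝 0)) ∧
    -- positive diagrams, connected or not, need no renormalisation and do not contribute
    (∀ (n : Fin k → ℕ) (κ : Pairing n), (∀ i, 1 ≤ n i) → (paired n κ).IsPositive →
        (∀ ε : ℝ, 0 < ε → ε < 1 → ∀ x : Fin k × Bool → Torus,
          (paired n κ).renVal ρ ε x = (paired n κ).val ρ ε x) ∧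
        ∀ φ : (Fin k × Bool → Torus) → ℝ, IsSmooth φ →
          (∃ C : ℝ, ∀ ε : ℝ, 0 < ε → ε < 1 → |(paired n κ).valTest ρ ε φ| ≤ C) ∧
          ((∃ i, 2 ≤ n i) → ∀ lam : ℝ,
            Filter.Tendsto
              (fun ε : ℝ => coupling lam ε ^ (∑ i, (n i - 1)) *
                (paired n κ).renValTest ρ ε φ)
              (𝓝[>] 0) (𝓝 0))) := by
  have hdegs : ∀ {n : Fin k → ℕ} {κ : Pairing n},
      ((paired n κ).IsPositive ∨ (paired n κ).IsZeroDegree) →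
      ∀ γ : (paired n κ).Subdiagram, 0 ≤ γ.degree := fun h =>
    h.elim (fun h => h.degree_nonneg) fun h => h.1
  have hsmall : ∀ᶠ ε : ℝ in 𝓝[>] 0, 0 < ε ∧ ε < 1 := by
    filter_upwards [self_mem_nhdsWithin, nhdsWithin_le_nhds (Iio_mem_nhds one_pos)] with ε h1 h2
    exact ⟨h1, h2⟩
  refine ⟨fun m ε₀ hε₀ hε₀1 => ?_, fun n κ hn hc hdeg hnb φ hφ lam => ?_,
    fun n κ hn hpos => ⟨fun ε _ _ x => hpos.renVal_eq (paired_exists_reachable κ) ρ ε x, ?_⟩⟩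
  -- The constant must be chosen before the diagram; the number of internal vertices is determined
  -- by `2|V⋆| = k + m`.
  · obtain ⟨C, hC0, hC⟩ := FeynmanDiagram.exists_valTest_le hρ ((k + m) / 2 - 1) m (2 * k)
    set σ₀ := coupling 1 ε₀
    have hσ₀ : 0 ≤ σ₀ := coupling_one_nonneg hε₀ hε₀1
    refine ⟨C * ((1 + σ₀ ^ 2) ^ (m / 2) * σ₀ ^ (m - 2 * (m / 2))), ?_⟩
    intro n κ hn hc hdeg hm φ hφ lam ε hε hle
    have hε1 := hle.trans_lt hε₀1
    have hcard := paired_two_mul_card_eq κ hn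
    have hcpos := paired_card_pos κ hk hn
    have hI : Nat.card (paired n κ).I = ((k + m) / 2 - 1) + 1 := by omega
    have hb := hC (paired n κ) (paired_hasLegs κ hn) (paired_not_pinned κ) hI
      (paired_card_leaves κ) hm (m / 2)
      (fun s hs i hi => FeynmanDiagram.mergedCount_le_of_degree_nonneg (hdegs hdeg) hs hi)
      (fun s hs => by
        have h1 := (two_mul_numZeros_le (mergedCount_monotone _ _ s) fun i hi =>
          FeynmanDiagram.mergedCount_le_of_degree_nonneg (hdegs hdeg) hs hi).1
        rw [FeynmanDiagram.mergedCount_eq_numIntEdges _ hI hs, hm] at h1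
        omega) φ _ hφ.abs_le_iSup ε hε hε1
    have hM0 : 0 ≤ ⨆ x, |φ x| := (abs_nonneg _).trans (hφ.abs_le_iSup fun _ => 0)
    have hσ := coupling_one_nonneg hε hε1
    have hσle := coupling_one_le hε hle hε₀1
    calc |coupling lam ε| ^ m * |(paired n κ).valTest ρ ε φ|
        ≤ |coupling lam ε| ^ m * (C * (⨆ x, |φ x|) * logFactor ε ^ (m / 2)) := by gcongr
      _ = C * (⨆ x, |φ x|) * (|coupling lam ε| ^ m * logFactor ε ^ (m / 2)) := by ring
      _ = C * (⨆ x, |φ x|) * (|lam| ^ m *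
          ((1 + coupling 1 ε ^ 2) ^ (m / 2) * coupling 1 ε ^ (m - 2 * (m / 2)))) := by
          rw [coupling_pow_mul_logFactor_pow hε hε1 (by omega)]
      _ ≤ C * (⨆ x, |φ x|) * (|lam| ^ m *
          ((1 + σ₀ ^ 2) ^ (m / 2) * σ₀ ^ (m - 2 * (m / 2)))) := by gcongr
      _ = _ := by ring
  · set m := (paired n κ).numIntEdges with hm
    have hcpos := paired_card_pos κ hk hn
    obtain ⟨N, hI⟩ : ∃ N, Nat.card (paired n κ).I = N + 1 := ⟨_, (Nat.sub_add_cancel hcpos).symm⟩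
    obtain ⟨C, hC0, hC⟩ := FeynmanDiagram.exists_valTest_le hρ N m (2 * k)
    have hZ : ∀ s, MergeIndep s N → 2 * numZeros (fun i => 4 * i - 2 *
        mergedCount (paired n κ).intSrc (paired n κ).intTgt s i) N < m := fun s hs =>
      (paired_hasLegs κ hn).two_mul_numZeros_lt hc (hdegs hdeg) (paired_card_leaves κ)
        (paired_two_mul_card_eq κ hn) hnb hI hs
    have hm1 : 1 ≤ m := by
      -- Only the existence of some merge sequence matters here, so the distance is arbitrary.
      obtain ⟨s, hs, _⟩ := exists_greedy hI fun _ _ => 0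
      have := hZ s hs
      omega
    have hg : Filter.Tendsto (fun ε => C * (⨆ x, |φ x|) * (|lam| ^ m *
        ((1 + coupling 1 ε ^ 2) ^ ((m - 1) / 2) * coupling 1 ε ^ (m - 2 * ((m - 1) / 2)))))
        (𝓝[>] 0) (𝓝 0) := by
      have hcont : Continuous fun σ : ℝ => C * (⨆ x, |φ x|) * (|lam| ^ m *
          ((1 + σ ^ 2) ^ ((m - 1) / 2) * σ ^ (m - 2 * ((m - 1) / 2)))) := by fun_prop
      have := (hcont.tendsto 0).comp tendsto_coupling_one
      rw [zero_pow (by omega : m - 2 * ((m - 1) / 2) ≠ 0), mul_zero, mul_zero, mul_zero] at this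
      exact this
    refine squeeze_zero' (Filter.Eventually.of_forall fun ε => by positivity) ?_ hg
    filter_upwards [hsmall] with ε hε
    have hb := hC (paired n κ) (paired_hasLegs κ hn) (paired_not_pinned κ) hI
      -- The largest `Z` with `2 * Z < m`, so that at least one power of the coupling is left.
      (paired_card_leaves κ) rfl ((m - 1) / 2)
      (fun s hs i hi => FeynmanDiagram.mergedCount_le_of_degree_nonneg (hdegs hdeg) hs hi)
      (fun s hs => by have := hZ s hs; omega) φ _ hφ.abs_le_iSup ε hε.1 hε.2
    rw [← coupling_pow_mul_logFactor_pow hε.1 hε.2 (by omega)]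
    calc |coupling lam ε| ^ m * |(paired n κ).valTest ρ ε φ|
        ≤ |coupling lam ε| ^ m * (C * (⨆ x, |φ x|) * logFactor ε ^ ((m - 1) / 2)) := by gcongr
      _ = _ := by ring
  · intro φ hφ
    have hcpos := paired_card_pos κ hk hn
    obtain ⟨N, hI⟩ : ∃ N, Nat.card (paired n κ).I = N + 1 := ⟨_, (Nat.sub_add_cancel hcpos).symm⟩
    obtain ⟨C, hC0, hC⟩ := FeynmanDiagram.exists_valTest_le hρ N (paired n κ).numIntEdges (2 * k)
    have hb : ∀ ε : ℝ, 0 < ε → ε < 1 → |(paired n κ).valTest ρ ε φ| ≤ C * ⨆ x, |φ x| := by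
      intro ε hε hε1
      have := hC (paired n κ) (paired_hasLegs κ hn) (paired_not_pinned κ) hI
        (paired_card_leaves κ) rfl 0
        (fun s hs i hi => FeynmanDiagram.mergedCount_le_of_degree_nonneg hpos.degree_nonneg hs hi)
        (fun s hs => by
          refine Nat.le_zero.2 (Finset.card_eq_zero.2 (Finset.filter_eq_empty_iff.2 ?_))
          intro i hi h0
          have h0' : 4 * (i + 1) - 2 * mergedCount (paired n κ).intSrc (paired n κ).intTgt s
            (i + 1) = 0 := h0
          have := hpos.mergedCount_lt hs (Finset.mem_range.1 hi)
          omega) φ _ hφ.abs_le_iSup ε hε hε1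
      rwa [pow_zero, mul_one] at this
    refine ⟨⟨_, hb⟩, fun ⟨i, hi⟩ lam => ?_⟩
    have hp : ∑ i, (n i - 1) ≠ 0 := by
      intro h0
      have := Finset.sum_eq_zero_iff.1 h0 i (Finset.mem_univ i)
      omega
    set p := ∑ i, (n i - 1)
    -- There is no logarithm here, so `coupling_pow_mul_logFactor_pow` is applied with `Z = 0` and
    -- all `p` couplings give decay.
    have hg : Filter.Tendsto (fun ε => |lam| ^ p * ((1 + coupling 1 ε ^ 2) ^ 0 *
        coupling 1 ε ^ (p - 2 * 0)) * (C * ⨆ x, |φ x|)) (𝓝[>] 0) (𝓝 0) := by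
      have hcont : Continuous fun σ : ℝ => |lam| ^ p * ((1 + σ ^ 2) ^ 0 *
        σ ^ (p - 2 * 0)) * (C * ⨆ x, |φ x|) := by fun_prop
      have := (hcont.tendsto 0).comp tendsto_coupling_one
      rw [zero_pow (by omega : p - 2 * 0 ≠ 0), mul_zero, mul_zero, mul_zero, zero_mul] at this
      exact this
    refine squeeze_zero_norm' ?_ hg
    filter_upwards [hsmall] with ε hε
    have hren : (paired n κ).renValTest ρ ε φ = (paired n κ).valTest ρ ε φ := by
      unfold FeynmanDiagram.renValTest FeynmanDiagram.valTest
      simp_rw [hpos.renVal_eq (paired_exists_reachable κ)]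
    rw [hren, norm_mul, norm_pow, Real.norm_eq_abs, Real.norm_eq_abs,
      ← coupling_pow_mul_logFactor_pow hε.1 hε.2 (by omega), pow_zero, mul_one]
    exact mul_le_mul_of_nonneg_left (hb ε hε.1 hε.2) (by positivity)
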